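/- Let $\mathscr H$ be a finite-dimensional real Hilbert space, $F:\mathscr H\to 2^{\mathscr H}$ a set-valued operator, $G:\mathscr H\to\mathscr H$ a map, $\eta_F,\eta_G\in\mathbb R$, $L\ge 0$ and $\gamma>0$. An operator $A:\mathscr H\to 2^{\mathscr H}$ is $\eta$-monotone if $\langle z-y,u-w\rangle\ge\eta\|z-y\|^2$ for all $z,y\in\mathscr H$, $u\in A(z)$, $w\in A(y)$, and maximal $\eta$-monotone if moreover its graph is not properly contained in the graph of another $\eta$-monotone operator. Assume that (A) $F$ is maximal $\eta_F$-monotone, $G$ is $\eta_G$-monotone and $L$-Lipschitz continuous, $1+\gamma\eta_F>0$ and $2(\eta_F+\eta_G)+\gamma\eta_F^2-\gamma L^2>0$. Then the resolvent $J_{\gamma F}=(\mathrm{Id}+\gamma F)^{-1}$ is single-valued and defined on all of $\mathscr H$, the operator $B(z)=J_{\gamma F}(z-\gamma G(z))$ has a Lipschitz constant in $(0,1)$, and the inclusion $0\in F(z)+G(z)$ has exactly one solution $z^*$. Put $\Phi(z)=z-B(z)$. For $b_1,b_2,b_3>0$, $p_1\in(0,1)$, $p_2>1$, $p_3\ge 0$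 and $K_p,T_p>0$ consider $$\dot z=-\frac{K_p}{T_p}\,\omega(z)\Phi(z),\qquad \omega(z)=\frac{b_1}{\|\Phi(z)\|^{1-p_1}}+\frac{b_2}{\|\Phi(z)\|^{1-p_2}}+\frac{b_3}{\|\Phi(z)\|^{p_3}}\ \text{ if }\Phi(z)\ne 0,\qquad \omega(z)=0\ \text{ if }\Phi(z)=0. \tag{1}$$ A solution of (1) is a locally absolutely continuous curve $z:[0,\infty)\to\mathscr H$ that satisfies (1) almost everywhere (if $p_3<1$ the right-hand side is continuous and this means a $C^1$ solution). Its settling time $T(z(0))$ is the infimum of all $T\ge 0$ such that $z(t)=z^*$ for all $t\ge T$ ($+\infty$ if there is no such $T$). 1. The point $z^*$ is the only equilibrium of (1); for every initial condition in $\mathscr H$ there is exactly one solution of (1); and $z^*$ is globally fixed-time stable: it is Lyapunov stable, every settling time is finite, and the settling times are bounded uniformly over all initial conditions in $\mathscr H$. 2. Let $c\in(0,1)$ be any Lipschitz constant of $B$, and put $$r_1=\frac{1+p_1}2\in(\tfrac12,1),\quad r_2=\frac{1+p_2}2>1,\quad M_1=2^{\frac{1+p_1}2}\frac{K_p}{T_p}\frac{b_1(1-c)}{(1+c)^{1-p_1}}>0,\quad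 M_2=2^{\frac{1+p_2}2}\frac{K_p}{T_p}(1-c)^{p_2}b_2>0 .$$ Then for every initial condition $$T(z(0))\le\frac1{M_1(1-r_1)}+\frac1{M_2(r_2-1)} .$$ If $r_1=1-\frac1{2\zeta}$ and $r_2=1+\frac1{2\zeta}$ for some $\zeta>1$, then also $$T(z(0))\le\frac{\pi\zeta}{\sqrt{M_1M_2}} .$$ 3. Let $p_3=0$, let $c\in(0,1)$ be any Lipschitz constant of $B$, and choose $$K_p=\frac1{b_3(1-c)(1-p_1)}\ln\!\Big(1+\frac{b_3\,2^{\frac{1-p_1}2}(1+c)^{1-p_1}}{b_1}\Big)+\frac1{b_3(1-c)(p_2-1)}\ln\!\Big(1+\frac{b_3\,2^{\frac{1-p_2}2}(1-c)^{1-p_2}}{b_2}\Big),$$ which is positive. Then for every prescribed $T_p>0$ and every initial condition, $T(z(0))\le T_p$; that is, the solution of (1) satisfies $z(t)=z^*$ for all $t\ge T_p$. -/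

import Mathlib

open MeasureTheory
open scoped NNReal ENNReal Pointwise

namespace InclusionFlow

section Operators

variable {H : Type*} [NormedAddCommGroup H] [InnerProductSpace ℝ H]

/-- `η`-monotonicity of a set-valued operator; `η` may be negative. -/
def IsMonotoneWith (η : ℝ) (F : H → Set H) : Prop :=
  ∀ z y u w : H, u ∈ F z → w ∈ F y → η * ‖z - y‖ ^ 2 ≤ inner ℝ (z - y) (u - w)

/-- Maximal `η`-monotonicity: no `η`-monotone operator has a strictly larger graph. -/
def IsMaximalMonotoneWith (η : ℝ) (F : H → Set H) : Prop :=
  IsMonotoneWith η F ∧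
    ∀ F' : H → Set H, IsMonotoneWith η F' → (∀ z, F z ⊆ F' z) → F' = F

/-- The inclusion `0 ∈ F(z) + G(z)`. -/
def SolvesInclusion (F : H → Set H) (G : H → H) (z : H) : Prop :=
  (0 : H) ∈ F z + {G z}

/-- The set-valued resolvent `(Id + γ F)⁻¹`. -/
def resolventVal (F : H → Set H) (γ : ℝ) (x : H) : Set H :=
  {y | x ∈ ({y} : Set H) + γ • F y}

open Classical in
/-- The resolvent as a map `H → H`: the element of `(Id + γ F)⁻¹ x`
(and `0` at points where this set is empty). -/
noncomputable def resolventMap (F : H → Set H) (γ : ℝ) (x : H) : H :=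
  if h : (resolventVal F γ x).Nonempty then h.some else 0

/-- The forward-backward operator `B(z) = J_{γF}(z - γ G(z))`. -/
noncomputable def forwardBackward (F : H → Set H) (G : H → H) (γ : ℝ) (z : H) : H :=
  resolventMap F γ (z - γ • G z)

/-- The residual `Φ(z) = z - J_{γF}(z - γ G(z))`. -/
noncomputable def residual (F : H → Set H) (G : H → H) (γ : ℝ) (z : H) : H :=
  z - forwardBackward F G γ z

/-- `c ∈ (0,1)` is a Lipschitz constant of the forward-backward operator. -/
def IsContractionConstant (F : H → Set H) (G : H → H) (γ c : ℝ) : Prop :=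
  0 < c ∧ c < 1 ∧
    ∀ x y : H, ‖forwardBackward F G γ x - forwardBackward F G γ y‖ ≤ c * ‖x - y‖

open Classical in
/-- The scalar weight `ω(z)`, which is `0` on the zero set of `Φ`. -/
noncomputable def weight (F : H → Set H) (G : H → H) (γ b₁ b₂ b₃ p₁ p₂ p₃ : ℝ) (z : H) : ℝ :=
  if residual F G γ z = 0 then 0
  else b₁ * (1 / ‖residual F G γ z‖ ^ (1 - p₁)) + b₂ * (1 / ‖residual F G γ z‖ ^ (1 - p₂))
    + b₃ * (1 / ‖residual F G γ z‖ ^ p₃)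

/-- The right-hand side `-(K_p / T_p) ω(z) Φ(z)`. -/
noncomputable def flowField (F : H → Set H) (G : H → H) (γ b₁ b₂ b₃ p₁ p₂ p₃ Kp Tp : ℝ)
    (z : H) : H :=
  -((Kp / Tp) * weight F G γ b₁ b₂ b₃ p₁ p₂ p₃ z) • residual F G γ z

end Operators

section Stability

variable {H : Type*} [NormedAddCommGroup H] [NormedSpace ℝ H]

/-- Global forward solution of `ż = f(z)` on `[0, ∞)` in the sense of Carathéodory, that is,
a locally absolutely continuous curve satisfying the equation almost everywhere, written in
integral form. For continuous `f` these are exactly the `C¹` solutions.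
Values of `z` at negative times play no role. -/
def IsSolution (f : H → H) (z : ℝ → H) : Prop :=
  ∀ t : ℝ, 0 ≤ t → IntervalIntegrable (fun s => f (z s)) volume 0 t ∧
    z t = z 0 + ∫ s in (0 : ℝ)..t, f (z s)

/-- Every initial condition has a global forward solution, and only one. -/
def IsWellPosed (f : H → H) : Prop :=
  (∀ z₀ : H, ∃ z : ℝ → H, IsSolution f z ∧ z 0 = z₀) ∧
    ∀ z y : ℝ → H, IsSolution f z → IsSolution f y → z 0 = y 0 → ∀ t, 0 ≤ t → z t = y t

/-- The settling time of the curve `z` at `zs`: the infimum of the times `T ≥ 0` such that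
`z(t) = zs` for all `t ≥ T`, and `∞` if there is no such time. -/
noncomputable def settlingTime (z : ℝ → H) (zs : H) : ℝ≥0∞ :=
  ⨅ (T : ℝ≥0) (_ : ∀ t : ℝ, (T : ℝ) ≤ t → z t = zs), (T : ℝ≥0∞)

def IsLyapunovStable (f : H → H) (zs : H) : Prop :=
  ∀ ε : ℝ, 0 < ε → ∃ r : ℝ, 0 < r ∧ ∀ z : ℝ → H, IsSolution f z →
    z 0 ∈ Metric.ball zs r → ∀ t : ℝ, 0 ≤ t → z t ∈ Metric.ball zs ε

def IsGloballyFiniteTimeStable (f : H → H) (zs : H) : Prop :=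
  f zs = 0 ∧ IsLyapunovStable f zs ∧
    ∀ z : ℝ → H, IsSolution f z → settlingTime z zs < ∞

def IsGloballyFixedTimeStable (f : H → H) (zs : H) : Prop :=
  IsGloballyFiniteTimeStable f zs ∧
    ∃ Tmax : ℝ≥0, ∀ z : ℝ → H, IsSolution f z → settlingTime z zs ≤ Tmax

end Stability

/-- The explicit gain `K_p` of the predefined-time regime. -/
noncomputable def predefinedGain (c b₁ b₂ b₃ p₁ p₂ : ℝ) : ℝ :=
  1 / (b₃ * (1 - c) * (1 - p₁)) *
      Real.log (1 + b₃ * (2 : ℝ) ^ ((1 - p₁) / 2) * (1 + c) ^ (1 - p₁) / b₁)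
    + 1 / (b₃ * (1 - c) * (p₂ - 1)) *
      Real.log (1 + b₃ * (2 : ℝ) ^ ((1 - p₂) / 2) * (1 - c) ^ (1 - p₂) / b₂)

end InclusionFlow

open InclusionFlow

/-! The resolvent is `1 / (1 + γηF)`-Lipschitz, and the forward step has squared Lipschitz constant
`1 - 2γηG + γ²L²`, which by assumption is below `(1 + γηF)²`. So `B` is a contraction and `z*` is
its fixed point. That the resolvent is defined everywhere is Minty's theorem, obtained from a
Kirszbraun-type ball intersection property (`exists_forall_norm_sub_le`).

If `c` is a contraction constant, `‖Φ x‖` lies between `(1 ∓ c)‖x - z*‖` and `⟨x - z*, Φ x⟩ ≥ (1 -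
c)‖x - z*‖²`. Hence `V = ‖z - z*‖² / 2` satisfies `V' ≤ -(M₁ V^r₁ + M₂ V^r₂ + M₃ V)` off `z*`
(`IsResidualLike.decay_le`), with `M₃ > 0` available when `p₃ = 0`. Integrating `dV / D(V)` for
suitable minorants `D` of the decay rate gives all three time bounds.

Well-posedness is delicate only at `z*`, where the field may be unbounded. The distance to `z*`
never increases, so `z*` is absorbing and uniqueness reduces to annuli where the field is Lipschitz.
Existence comes from the bounded Lipschitz field `-Φ / (1 + ‖Φ‖)`, which has the same orbits: its
curve is reparametrised, then continued by the constant `z*`. -/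

namespace InclusionFlow

/-! ### Intersection of balls under a nonexpansiveness condition. -/

section Extension

variable {H : Type*} [NormedAddCommGroup H] [InnerProductSpace ℝ H]

/-- Two expressions for twice a weighted variance; this turns bounds on pairwise distances into
bounds on variances. -/
theorem sum_sum_mul_norm_sub_sq {ι : Type*} [Fintype ι] (w : ι → ℝ) (hw : ∑ i, w i = 1)
    (u : ι → H) :
    ∑ i, ∑ j, w i * w j * ‖u i - u j‖ ^ 2 =
      2 * (∑ i, w i * ‖u i‖ ^ 2 - ‖∑ i, w i • u i‖ ^ 2) := by
  have h1 : ∑ i, ∑ j, w i * w j * ‖u i‖ ^ 2 = ∑ i, w i * ‖u i‖ ^ 2 := by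
    refine Finset.sum_congr rfl fun i _ => ?_
    rw [← Finset.sum_mul, ← Finset.mul_sum, hw, mul_one]
  have h2 : ∑ i, ∑ j, w i * w j * ‖u j‖ ^ 2 = ∑ i, w i * ‖u i‖ ^ 2 := by
    rw [Finset.sum_comm]
    refine Finset.sum_congr rfl fun i _ => ?_
    rw [← Finset.sum_mul, ← Finset.sum_mul, hw, one_mul]
  have h3 : ∑ i, ∑ j, w i * w j * inner ℝ (u i) (u j) = ‖∑ i, w i • u i‖ ^ 2 := by
    rw [← real_inner_self_eq_norm_sq, sum_inner]
    refine Finset.sum_congr rfl fun i _ => ?_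
    rw [inner_sum]
    refine Finset.sum_congr rfl fun j _ => ?_
    rw [real_inner_smul_left, real_inner_smul_right, mul_assoc]
  have h4 : ∀ i j, w i * w j * ‖u i - u j‖ ^ 2 =
      w i * w j * ‖u i‖ ^ 2 + w i * w j * ‖u j‖ ^ 2 - 2 * (w i * w j * inner ℝ (u i) (u j)) := by
    intro i j
    rw [norm_sub_sq_real]
    ring
  simp only [h4, Finset.sum_sub_distrib, Finset.sum_add_distrib, ← Finset.mul_sum, h1, h2, h3]
  ring

/-- Extracts a first-order condition at a maximiser; the single value `t = A / (A + B)` already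
excludes `A > 0`. -/
theorem nonpos_of_forall_le_mul {A B : ℝ} (hB : 0 ≤ B)
    (h : ∀ t : ℝ, 0 < t → t ≤ 1 → A ≤ t * B) : A ≤ 0 := by
  by_contra hA
  push Not at hA
  have h1 := h (A / (A + B)) (by positivity) (by rw [div_le_one (by positivity)]; linarith)
  rw [div_mul_eq_mul_div, le_div_iff₀ (by positivity)] at h1
  nlinarith

/-- The one-point extension property of nonexpansive maps on finite sets, at the origin. -/
theorem exists_forall_norm_sub_le_of_fintype {ι : Type*} [Fintype ι] [Nonempty ι] (u v : ι → H)
    (h : ∀ i j, ‖u i - u j‖ ^ 2 ≤ ‖v i - v j‖ ^ 2) : ∃ y : H, ∀ i, ‖y - u i‖ ≤ ‖v i‖ := by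
  classical
  -- Minimax duality: `g w` is the minimum over `y` of `∑ wᵢ (‖y - uᵢ‖² - ‖vᵢ‖²)`, attained at the
  -- barycentre. The barycentre of a maximiser of `g` is the required point.
  set k : ι → ℝ := fun i => ‖u i‖ ^ 2 - ‖v i‖ ^ 2 with hk
  set g : (ι → ℝ) → ℝ := fun w => ∑ i, w i * k i - ‖∑ i, w i • u i‖ ^ 2 with hg
  have hgc : Continuous g := by fun_prop
  obtain ⟨w, hw, hmax⟩ := (isCompact_stdSimplex ℝ ι).exists_isMaxOn
    ⟨_, single_mem_stdSimplex ℝ (Classical.arbitrary ι)⟩ hgc.continuousOn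
  -- `g w` is the variance of `u` minus `∑ wᵢ ‖vᵢ‖²`, and the variance of `u` is at most that of
  -- `v`.
  have hgw : g w ≤ 0 := by
    have h1 := sum_sum_mul_norm_sub_sq w hw.2 u
    have h2 := sum_sum_mul_norm_sub_sq w hw.2 v
    have h3 : ∑ i, ∑ j, w i * w j * ‖u i - u j‖ ^ 2 ≤ ∑ i, ∑ j, w i * w j * ‖v i - v j‖ ^ 2 :=
      Finset.sum_le_sum fun i _ => Finset.sum_le_sum fun j _ =>
        mul_le_mul_of_nonneg_left (h i j) (mul_nonneg (hw.1 i) (hw.1 j))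
    have h4 : g w = ∑ i, w i * ‖u i‖ ^ 2 - ∑ i, w i * ‖v i‖ ^ 2 - ‖∑ i, w i • u i‖ ^ 2 := by
      simp only [hg, hk, mul_sub, Finset.sum_sub_distrib]
    have h5 := sq_nonneg ‖∑ i, w i • v i‖
    linarith
  refine ⟨∑ i, w i • u i, fun i => ?_⟩
  set y := ∑ i, w i • u i with hy
  set S := ∑ i, w i * k i with hS
  -- First-order optimality of `w` towards the `i`-th vertex of the simplex.
  have key : k i - S - 2 * inner ℝ y (u i - y) ≤ 0 := by
    refine nonpos_of_forall_le_mul (sq_nonneg ‖u i - y‖) fun t ht ht1 => ?_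
    have hmem : (1 - t) • w + t • Pi.single i 1 ∈ stdSimplex ℝ ι :=
      (convex_stdSimplex ℝ ι) hw (single_mem_stdSimplex ℝ i) (by linarith) ht.le (by ring)
    have h1 : g ((1 - t) • w + t • Pi.single i 1) ≤ g w := hmax hmem
    have h2 : ∑ j, ((1 - t) • w + t • Pi.single i 1 : ι → ℝ) j * k j = (1 - t) * S + t * k i := by
      simp [add_mul, Finset.sum_add_distrib, mul_assoc, ← Finset.mul_sum, hS, Pi.single_apply]
    have h3 : ∑ j, ((1 - t) • w + t • Pi.single i 1 : ι → ℝ) j • u j = y + t • (u i - y) := by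
      have : ∑ j, ((1 - t) • w + t • Pi.single i 1 : ι → ℝ) j • u j = (1 - t) • y + t • u i := by
        simp [add_smul, Finset.sum_add_distrib, mul_smul, ← Finset.smul_sum, hy, Pi.single_apply]
      rw [this]
      module
    simp only [hg] at h1
    rw [h2, h3, norm_add_sq_real, real_inner_smul_right, norm_smul, Real.norm_of_nonneg ht.le] at h1
    have h4 : t * (k i - S - 2 * inner ℝ y (u i - y)) ≤ t * (t * ‖u i - y‖ ^ 2) := by nlinarith
    exact le_of_mul_le_mul_left h4 ht
  have h6 : ‖y - u i‖ ^ 2 ≤ ‖v i‖ ^ 2 := by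
    have e1 : g w = S - ‖y‖ ^ 2 := rfl
    have e2 : ‖y - u i‖ ^ 2 = ‖y‖ ^ 2 - 2 * inner ℝ y (u i) + ‖u i‖ ^ 2 := norm_sub_sq_real _ _
    have e3 : inner ℝ y (u i - y) = inner ℝ y (u i) - ‖y‖ ^ 2 := by
      rw [inner_sub_right, real_inner_self_eq_norm_sq]
    have e4 : k i = ‖u i‖ ^ 2 - ‖v i‖ ^ 2 := rfl
    linarith
  exact le_of_sq_le_sq h6 (norm_nonneg _)

/-- Closed balls are compact, so the finite intersection property reduces to finite families; `i₀`
is added to each of them because its ball serves as the ambient compact set. -/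
theorem exists_forall_norm_sub_le [FiniteDimensional ℝ H] {ι : Type*} (u v : ι → H)
    (h : ∀ i j, ‖u i - u j‖ ^ 2 ≤ ‖v i - v j‖ ^ 2) : ∃ y : H, ∀ i, ‖y - u i‖ ≤ ‖v i‖ := by
  classical
  rcases isEmpty_or_nonempty ι with hι | ⟨⟨i₀⟩⟩
  · exact ⟨0, fun i => hι.elim i⟩
  obtain ⟨y, -, hy⟩ := (isCompact_closedBall (u i₀) ‖v i₀‖).inter_iInter_nonempty
    (fun i => Metric.closedBall (u i) ‖v i‖) (fun _ => Metric.isClosed_closedBall) fun s => by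
      have : Nonempty (insert i₀ s : Finset ι) := ⟨⟨i₀, Finset.mem_insert_self _ _⟩⟩
      obtain ⟨y, hy⟩ := exists_forall_norm_sub_le_of_fintype
        (fun i : (insert i₀ s : Finset ι) => u i) (fun i => v i) fun i j => h i j
      refine ⟨y, ?_, ?_⟩
      · simpa [dist_eq_norm] using hy ⟨i₀, Finset.mem_insert_self _ _⟩
      · simp only [Set.mem_iInter, Metric.mem_closedBall, dist_eq_norm]
        exact fun i hi => hy ⟨i, Finset.mem_insert_of_mem hi⟩
  exact ⟨y, fun i => by simpa [dist_eq_norm] using Set.mem_iInter.1 hy i⟩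

end Extension

/-! ### Minty's theorem, the resolvent, and contractivity of the forward-backward operator. -/

section Resolvent

variable {H : Type*} [NormedAddCommGroup H] [InnerProductSpace ℝ H] {F : H → Set H} {G : H → H}
  {ηF ηG γ : ℝ} {L : ℝ≥0}

theorem mem_resolventVal {x y : H} : y ∈ resolventVal F γ x ↔ ∃ w ∈ F y, y + γ • w = x := by
  simp [resolventVal, Set.mem_smul_set, eq_neg_add_iff_add_eq]

/-- Adjoining `(y, w)` to the graph preserves monotonicity, so by maximality the pair was already
there. -/
theorem IsMaximalMonotoneWith.mem_of_forall (hF : IsMaximalMonotoneWith ηF F) {y w : H}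
    (h : ∀ a b, b ∈ F a → ηF * ‖y - a‖ ^ 2 ≤ inner ℝ (y - a) (w - b)) : w ∈ F y := by
  have h1 := hF.2 (fun z => {b | b ∈ F z ∨ (z = y ∧ b = w)}) ?_ fun z b hb => Or.inl hb
  · rw [← h1]
    exact Or.inr ⟨rfl, rfl⟩
  · rintro z z' b b' (hb | ⟨rfl, rfl⟩) (hb' | ⟨rfl, rfl⟩)
    · exact hF.1 _ _ _ _ hb hb'
    · have h2 := h _ _ hb
      rwa [norm_sub_rev, ← neg_sub z, ← neg_sub b, inner_neg_neg] at h2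
    · exact h _ _ hb'
    · simp

/-- **Minty's theorem** for `η`-monotone operators. -/
theorem IsMaximalMonotoneWith.exists_mem_resolventVal [FiniteDimensional ℝ H]
    (hF : IsMaximalMonotoneWith ηF F) (hγ : 0 < γ) (hγF : 0 < 1 + γ * ηF) (x : H) :
    ∃ y, y ∈ resolventVal F γ x := by
  set μ := 1 + γ * ηF with hμ
  -- The wanted `y` has `γ⁻¹(x - y) ∈ F y`. Tested against a graph point `(a, b)` this reads `⟨y -
  -- a, d⟩ ≥ ‖y - a‖²` with `μ d = x - γb - a`, that is, `y` lies in the ball with diameter `[a, a +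
  -- d]`.
  obtain ⟨d, hμd⟩ : ∃ d : {p : H × H // p.2 ∈ F p.1} → H,
      ∀ p, μ • d p = x - γ • p.1.2 - p.1.1 :=
    ⟨fun p => μ⁻¹ • (x - γ • p.1.2 - p.1.1), fun p => smul_inv_smul₀ hγF.ne' _⟩
  -- For these centres and radius vectors the pairwise condition is equivalent to `ηF`-monotonicity
  -- of `F`.
  obtain ⟨y, hy⟩ := exists_forall_norm_sub_le (fun p => p.1.1 + (2⁻¹ : ℝ) • d p)
    (fun p => (2⁻¹ : ℝ) • d p) (by
      intro p q
      have h1 := hF.1 _ _ _ _ p.2 q.2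
      have e1 : p.1.1 + (2⁻¹ : ℝ) • d p - (q.1.1 + (2⁻¹ : ℝ) • d q) =
        (p.1.1 - q.1.1) + ((2⁻¹ : ℝ) • d p - (2⁻¹ : ℝ) • d q) := by abel
      have e2 : μ * inner ℝ (p.1.1 - q.1.1) ((2⁻¹ : ℝ) • d p - (2⁻¹ : ℝ) • d q) =
          2⁻¹ * (- (γ * inner ℝ (p.1.1 - q.1.1) (p.1.2 - q.1.2)) - ‖p.1.1 - q.1.1‖ ^ 2) := by
        rw [← real_inner_smul_right]
        have : μ • ((2⁻¹ : ℝ) • d p - (2⁻¹ : ℝ) • d q) =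
            (2⁻¹ : ℝ) • (-(γ • (p.1.2 - q.1.2)) - (p.1.1 - q.1.1)) := by
          rw [smul_sub, smul_comm μ _ (d p), smul_comm μ _ (d q), hμd, hμd]
          module
        rw [this, real_inner_smul_right, inner_sub_right, inner_neg_right, real_inner_smul_right,
          real_inner_self_eq_norm_sq]
      rw [e1, norm_add_sq_real]
      have h2 := mul_le_mul_of_nonneg_left h1 hγ.le
      have h3 : μ * (‖p.1.1 - q.1.1‖ ^ 2 +
        2 * inner ℝ (p.1.1 - q.1.1) ((2⁻¹ : ℝ) • d p - (2⁻¹ : ℝ) • d q)) ≤ 0 := by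
        rw [mul_add, mul_left_comm, e2, hμ]
        linarith
      have h4 := nonpos_of_mul_nonpos_right h3 hγF
      linarith)
  refine ⟨y, mem_resolventVal.2 ⟨γ⁻¹ • (x - y), hF.mem_of_forall fun a b hb => ?_, ?_⟩⟩
  · have h1 := hy ⟨(a, b), hb⟩
    have h2 : ‖(y - a) - (2⁻¹ : ℝ) • d ⟨(a, b), hb⟩‖ ^ 2 ≤ ‖(2⁻¹ : ℝ) • d ⟨(a, b), hb⟩‖ ^ 2 := by
      rw [sub_sub]
      exact pow_le_pow_left₀ (norm_nonneg _) h1 2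
    rw [norm_sub_sq_real, real_inner_smul_right] at h2
    have h3 : ‖y - a‖ ^ 2 ≤ inner ℝ (y - a) (d ⟨(a, b), hb⟩) := by linarith
    have h4 := mul_le_mul_of_nonneg_left h3 hγF.le
    rw [← real_inner_smul_right, hμd] at h4
    have e1 : x - γ • b - a = γ • (γ⁻¹ • (x - y) - b) + (y - a) := by
      rw [smul_sub, smul_inv_smul₀ hγ.ne']
      abel
    simp only [e1, inner_add_right, real_inner_smul_right, real_inner_self_eq_norm_sq] at h4
    rw [hμ] at h4
    have h5 : γ * (ηF * ‖y - a‖ ^ 2) ≤ γ * inner ℝ (y - a) (γ⁻¹ • (x - y) - b) := by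
      simp only [inner_sub_right, real_inner_smul_right] at h4 ⊢
      linarith
    exact le_of_mul_le_mul_left h5 hγ
  · rw [smul_inv_smul₀ hγ.ne']
    abel

/-- `Id + γF` is `(1 + γηF)`-monotone; Cauchy–Schwarz does the rest. -/
theorem IsMonotoneWith.norm_sub_le_of_mem_resolventVal (hF : IsMonotoneWith ηF F) (hγ : 0 < γ)
    {x x' y y' : H} (hy : y ∈ resolventVal F γ x) (hy' : y' ∈ resolventVal F γ x') :
    (1 + γ * ηF) * ‖y - y'‖ ≤ ‖x - x'‖ := by
  obtain ⟨w, hw, rfl⟩ := mem_resolventVal.1 hy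
  obtain ⟨w', hw', rfl⟩ := mem_resolventVal.1 hy'
  have h1 := mul_le_mul_of_nonneg_left (hF _ _ _ _ hw hw') hγ.le
  have h2 := real_inner_le_norm (y - y') (y + γ • w - (y' + γ • w'))
  have e : y + γ • w - (y' + γ • w') = (y - y') + γ • (w - w') := by module
  rcases (norm_nonneg (y - y')).eq_or_lt with h0 | h0
  · rw [← h0, mul_zero]
    exact norm_nonneg _
  · rw [e, inner_add_right, real_inner_smul_right, real_inner_self_eq_norm_sq, ← e] at h2
    refine le_of_mul_le_mul_left ?_ h0
    nlinarith

theorem existsUnique_mem_resolventVal [FiniteDimensional ℝ H] (hF : IsMaximalMonotoneWith ηF F)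
    (hγ : 0 < γ) (hγF : 0 < 1 + γ * ηF) (x : H) : ∃! y, y ∈ resolventVal F γ x := by
  obtain ⟨y, hy⟩ := hF.exists_mem_resolventVal hγ hγF x
  refine ⟨y, hy, fun y' hy' => ?_⟩
  have h1 := hF.1.norm_sub_le_of_mem_resolventVal hγ hy' hy
  rw [sub_self, norm_zero] at h1
  have h2 := nonpos_of_mul_nonpos_right h1 hγF
  exact sub_eq_zero.1 (norm_le_zero_iff.1 h2)

theorem resolventMap_mem {x : H} (h : ∃ y, y ∈ resolventVal F γ x) :
    resolventMap F γ x ∈ resolventVal F γ x := by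
  have h' : (resolventVal F γ x).Nonempty := h
  rw [resolventMap, dif_pos h']
  exact h'.some_mem

theorem norm_forward_sub_sq_le (hG : IsMonotoneWith ηG (fun z => {G z})) (hGL : LipschitzWith L G)
    (hγ : 0 < γ) (z y : H) :
    ‖(z - γ • G z) - (y - γ • G y)‖ ^ 2 ≤ (1 - 2 * γ * ηG + γ ^ 2 * L ^ 2) * ‖z - y‖ ^ 2 := by
  have h1 := mul_le_mul_of_nonneg_left (hG z y _ _ rfl rfl) hγ.le
  have h2 : ‖G z - G y‖ ^ 2 ≤ (L * ‖z - y‖) ^ 2 := by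
    refine pow_le_pow_left₀ (norm_nonneg _) ?_ 2
    simpa [dist_eq_norm] using hGL.dist_le_mul z y
  have h3 := mul_le_mul_of_nonneg_left h2 (sq_nonneg γ)
  have e : (z - γ • G z) - (y - γ • G y) = (z - y) - γ • (G z - G y) := by module
  rw [e, norm_sub_sq_real, real_inner_smul_right, norm_smul, Real.norm_of_nonneg hγ.le]
  nlinarith

theorem exists_isContractionConstant [FiniteDimensional ℝ H] (hF : IsMaximalMonotoneWith ηF F)
    (hG : IsMonotoneWith ηG (fun z => {G z})) (hGL : LipschitzWith L G)
    (hγ : 0 < γ) (hγF : 0 < 1 + γ * ηF)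
    (hA : 0 < 2 * (ηF + ηG) + γ * ηF ^ 2 - γ * (L : ℝ) ^ 2) :
    ∃ c : ℝ, IsContractionConstant F G γ c := by
  set q := 1 - 2 * γ * ηG + γ ^ 2 * (L : ℝ) ^ 2 with hq
  set μ := 1 + γ * ηF with hμ
  -- `μ² - q` is exactly `γ` times the quantity in `hA`.
  have hqμ : q < μ ^ 2 := by nlinarith [mul_pos hγ hA]
  -- The `1 / 2` only keeps the constant positive, since `√q` may vanish.
  refine ⟨max (1 / 2) (√q / μ), by positivity, ?_, fun x y => ?_⟩
  · refine max_lt (by norm_num) ?_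
    rw [div_lt_one hγF]
    exact (Real.sqrt_lt' hγF).2 hqμ
  · have h1 := hF.1.norm_sub_le_of_mem_resolventVal hγ
      (resolventMap_mem (hF.exists_mem_resolventVal hγ hγF (x - γ • G x)))
      (resolventMap_mem (hF.exists_mem_resolventVal hγ hγF (y - γ • G y)))
    have h2 : ‖(x - γ • G x) - (y - γ • G y)‖ ≤ √q * ‖x - y‖ := by
      have h3 := Real.sqrt_le_sqrt (norm_forward_sub_sq_le hG hGL hγ x y)
      rwa [Real.sqrt_sq (norm_nonneg _), Real.sqrt_mul' _ (sq_nonneg _),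
        Real.sqrt_sq (norm_nonneg _)] at h3
    calc ‖forwardBackward F G γ x - forwardBackward F G γ y‖ ≤ √q / μ * ‖x - y‖ := by
          rw [div_mul_eq_mul_div, le_div_iff₀ hγF, mul_comm]
          exact h1.trans h2
      _ ≤ _ := by gcongr; exact le_max_right _ _

theorem solvesInclusion_iff_residual_eq_zero [FiniteDimensional ℝ H]
    (hF : IsMaximalMonotoneWith ηF F) (hγ : 0 < γ) (hγF : 0 < 1 + γ * ηF) (z : H) :
    SolvesInclusion F G z ↔ residual F G γ z = 0 := by
  have h1 : SolvesInclusion F G z ↔ -G z ∈ F z := by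
    simp [SolvesInclusion]
  have h2 : -G z ∈ F z ↔ z ∈ resolventVal F γ (z - γ • G z) := by
    rw [mem_resolventVal]
    constructor
    · exact fun h => ⟨_, h, by module⟩
    · rintro ⟨w, hw, h⟩
      have : γ • w = γ • (-G z) := by
        rw [smul_neg]
        rw [sub_eq_add_neg] at h
        exact add_left_cancel h
      rwa [← (smul_right_injective H hγ.ne') this]
  have h3 := resolventMap_mem (hF.exists_mem_resolventVal hγ hγF (z - γ • G z))
  rw [h1, h2, residual, sub_eq_zero, forwardBackward]
  constructor
  · exact fun h => (existsUnique_mem_resolventVal hF hγ hγF _).unique h h3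
  · intro h
    rwa [← h] at h3

theorem IsContractionConstant.exists_residual_eq_zero [CompleteSpace H] {c : ℝ}
    (hc : IsContractionConstant F G γ c) : ∃ zs, residual F G γ zs = 0 := by
  have h : ContractingWith ⟨c, hc.1.le⟩ (forwardBackward F G γ) :=
    ⟨NNReal.coe_lt_coe.1 hc.2.1, LipschitzWith.of_dist_le_mul fun x y => by
      rw [dist_eq_norm, dist_eq_norm]
      exact hc.2.2 x y⟩
  exact ⟨_, sub_eq_zero.2 h.fixedPoint_isFixedPt.symm⟩

end Resolvent

/-! ### Two-sided bounds for the residual of a contraction. -/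

section Residual

variable {H : Type*} [NormedAddCommGroup H] [InnerProductSpace ℝ H]

/-- `Φ` is Lipschitz and strongly monotone around its zero `zs`, with the constants of
`Id - B` for a `c`-contraction `B`. -/
structure IsResidualLike (c : ℝ) (zs : H) (Φ : H → H) : Prop where
  pos : 0 < c
  lt_one : c < 1
  lipschitz : ∀ x y, ‖Φ x - Φ y‖ ≤ (1 + c) * ‖x - y‖
  norm_ge : ∀ x, (1 - c) * ‖x - zs‖ ≤ ‖Φ x‖
  norm_le : ∀ x, ‖Φ x‖ ≤ (1 + c) * ‖x - zs‖
  inner_ge : ∀ x, (1 - c) * ‖x - zs‖ ^ 2 ≤ inner ℝ (x - zs) (Φ x)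

theorem IsContractionConstant.isResidualLike {F : H → Set H} {G : H → H} {γ c : ℝ}
    (hc : IsContractionConstant F G γ c) {zs : H} (hzs : residual F G γ zs = 0) :
    IsResidualLike c zs (residual F G γ) := by
  have e : ∀ x y, residual F G γ x - residual F G γ y =
      (x - y) - (forwardBackward F G γ x - forwardBackward F G γ y) := by
    intro x y
    simp only [residual]
    abel
  have e' : ∀ x, residual F G γ x =
      (x - zs) - (forwardBackward F G γ x - forwardBackward F G γ zs) := by
    intro x
    rw [← e, hzs, sub_zero]
  have hl : ∀ x y, ‖residual F G γ x - residual F G γ y‖ ≤ (1 + c) * ‖x - y‖ := by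
    intro x y
    rw [e]
    linarith [norm_sub_le (x - y) (forwardBackward F G γ x - forwardBackward F G γ y),
      hc.2.2 x y]
  refine ⟨hc.1, hc.2.1, hl, fun x => ?_, fun x => ?_, fun x => ?_⟩
  · rw [e']
    linarith [norm_sub_norm_le (x - zs) (forwardBackward F G γ x - forwardBackward F G γ zs),
      hc.2.2 x zs]
  · simpa [hzs] using hl x zs
  · rw [e', inner_sub_right, real_inner_self_eq_norm_sq]
    have h1 := real_inner_le_norm (x - zs) (forwardBackward F G γ x - forwardBackward F G γ zs)
    have h2 := mul_le_mul_of_nonneg_left (hc.2.2 x zs) (norm_nonneg (x - zs))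
    linarith

theorem IsResidualLike.eq_zero_iff {c : ℝ} {zs : H} {Φ : H → H} (h : IsResidualLike c zs Φ)
    (x : H) : Φ x = 0 ↔ x = zs := by
  constructor
  · intro hx
    have h1 := h.norm_ge x
    rw [hx, norm_zero] at h1
    exact sub_eq_zero.1 (norm_le_zero_iff.1
      (nonpos_of_mul_nonpos_right h1 (sub_pos.2 h.lt_one)))
  · rintro rfl
    simpa using h.norm_le x

end Residual

/-! ### Solutions of a dissipative field that is singular at its zero. -/

section Dissipative

open Set Filter Topology

variable {H : Type*} [NormedAddCommGroup H] [InnerProductSpace ℝ H]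

/-- A field that does not point away from its zero `zs`, Lipschitz on annuli around `zs`
and possibly singular at `zs`. -/
structure IsDissipativeField (zs : H) (f : H → H) : Prop where
  zero : f zs = 0
  inner_nonpos : ∀ x, inner ℝ (x - zs) (f x) ≤ 0
  lipschitz : ∀ δ R : ℝ, 0 < δ →
    ∃ K : ℝ≥0, LipschitzOnWith K f {x | δ ≤ ‖x - zs‖ ∧ ‖x - zs‖ ≤ R}
  norm_mul_le : ∃ C : ℝ, 0 ≤ C ∧ ∀ x, ‖f x‖ * ‖x - zs‖ ≤ C * -inner ℝ (x - zs) (f x)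

/-- A curve on `[0, ∞)` that solves `ż = f(z)` classically away from `zs`. -/
structure IsCurveAwayFrom (zs : H) (f : H → H) (z : ℝ → H) : Prop where
  continuousOn : ContinuousOn z (Ici 0)
  hasDerivWithinAt : ∀ t, 0 ≤ t → z t ≠ zs → HasDerivWithinAt z (f (z t)) (Ici 0) t

variable {zs : H} {f : H → H} {z y : ℝ → H}

theorem IsDissipativeField.continuousAt (hf : IsDissipativeField zs f) {x : H} (hx : x ≠ zs) :
    ContinuousAt f x := by
  have hx0 : 0 < ‖x - zs‖ := norm_pos_iff.2 (sub_ne_zero.2 hx)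
  obtain ⟨K, hK⟩ := hf.lipschitz (‖x - zs‖ / 2) (‖x - zs‖ + 1) (by positivity)
  refine hK.continuousOn.continuousAt ?_
  have hc : ContinuousAt (fun w : H => ‖w - zs‖) x := by fun_prop
  filter_upwards [hc.eventually (Ioo_mem_nhds (a := ‖x - zs‖ / 2) (b := ‖x - zs‖ + 1)
    (by linarith) (by linarith))] with w hw
  exact ⟨hw.1.le, hw.2.le⟩

theorem IsSolution.continuousOn [CompleteSpace H] (hz : IsSolution f z) :
    ContinuousOn z (Ici 0) := by
  intro t ht
  have ht' : (0 : ℝ) ≤ t := ht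
  have h0 : (0 : ℝ) ≤ t + 1 := by linarith
  have h1 : ContinuousOn (fun u => z 0 + ∫ s in (0 : ℝ)..u, f (z s)) (Icc 0 (t + 1)) := by
    have := intervalIntegral.continuousOn_primitive_interval' (hz (t + 1) h0).1 left_mem_uIcc
    rw [uIcc_of_le h0] at this
    exact continuousOn_const.add this
  have h2 : ContinuousOn z (Icc 0 (t + 1)) := h1.congr fun s hs => (hz s hs.1).2
  exact (h2 t ⟨ht, by linarith⟩).mono_of_mem_nhdsWithin
    (inter_mem_nhdsWithin (Ici 0) (Iic_mem_nhds (by linarith)))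

theorem IsDissipativeField.isCurveAwayFrom [CompleteSpace H] (hf : IsDissipativeField zs f)
    (hz : IsSolution f z) : IsCurveAwayFrom zs f z := by
  refine ⟨hz.continuousOn, fun t ht hne => ?_⟩
  have h0 : (0 : ℝ) ≤ t + 1 := by linarith
  have hmem : t ∈ Icc (0 : ℝ) (t + 1) := ⟨ht, by linarith⟩
  have : Fact (t ∈ Icc (0 : ℝ) (t + 1)) := ⟨hmem⟩
  have hi := (intervalIntegrable_iff_integrableOn_Icc_of_le h0).1 (hz (t + 1) h0).1
  have hc : ContinuousWithinAt (fun s => f (z s)) (Icc 0 (t + 1)) t :=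
    (hf.continuousAt hne).comp_continuousWithinAt
      ((hz.continuousOn t ht).mono Icc_subset_Ici_self)
  have h1 : HasDerivWithinAt (fun u => ∫ s in (0 : ℝ)..u, f (z s)) (f (z t))
      (Icc 0 (t + 1)) t :=
    intervalIntegral.integral_hasDerivWithinAt_right (hz t ht).1
      ⟨_, self_mem_nhdsWithin, hi.aestronglyMeasurable⟩ hc
  have h2 : HasDerivWithinAt z (f (z t)) (Icc 0 (t + 1)) t :=
    (h1.const_add (z 0)).congr (fun s hs => (hz s hs.1).2) (hz t ht).2
  exact h2.mono_of_mem_nhdsWithin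
    (inter_mem_nhdsWithin (Ici 0) (Iic_mem_nhds (by linarith)))

theorem IsCurveAwayFrom.hasDerivAt (hz : IsCurveAwayFrom zs f z) {t : ℝ} (ht : 0 < t)
    (hne : z t ≠ zs) : HasDerivAt z (f (z t)) t :=
  (hz.hasDerivWithinAt t ht.le hne).hasDerivAt (Ici_mem_nhds ht)

theorem IsCurveAwayFrom.hasDerivAt_norm_sq (hz : IsCurveAwayFrom zs f z) {t : ℝ} (ht : 0 < t)
    (hne : z t ≠ zs) :
    HasDerivAt (fun s => ‖z s - zs‖ ^ 2) (2 * inner ℝ (z t - zs) (f (z t))) t :=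
  ((hz.hasDerivAt ht hne).sub_const zs).norm_sq

theorem IsCurveAwayFrom.continuousOn_norm (hz : IsCurveAwayFrom zs f z) :
    ContinuousOn (fun s => ‖z s - zs‖) (Ici 0) :=
  (hz.continuousOn.sub continuousOn_const).norm

/-- The squared distance has a nonpositive derivative, known only off `zs`. Monotonicity is
therefore applied after the last visit to `zs` in `[a, b]`, or from `a` if there is none. -/
theorem IsCurveAwayFrom.norm_le (hz : IsCurveAwayFrom zs f z) (hf : IsDissipativeField zs f)
    {a b : ℝ} (ha : 0 ≤ a) (hab : a ≤ b) : ‖z b - zs‖ ≤ ‖z a - zs‖ := by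
  have main : ∀ τ, a ≤ τ → τ ≤ b → (∀ s ∈ Ioo τ b, z s ≠ zs) → ‖z b - zs‖ ≤ ‖z τ - zs‖ := by
    intro τ hτ hτb hne
    refine le_of_sq_le_sq ?_ (norm_nonneg _)
    have hanti : AntitoneOn (fun s => ‖z s - zs‖ ^ 2) (Icc τ b) := by
      refine antitoneOn_of_hasDerivWithinAt_nonpos (convex_Icc _ _)
        (f' := fun t => 2 * inner ℝ (z t - zs) (f (z t)))
        ((hz.continuousOn_norm.pow 2).mono fun s hs => ha.trans (hτ.trans hs.1)) ?_ ?_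
      · intro s hs
        rw [interior_Icc] at hs
        exact (hz.hasDerivAt_norm_sq (by linarith [hs.1]) (hne s hs)).hasDerivWithinAt
      · intro s _
        linarith [hf.inner_nonpos (z s)]
    exact hanti ⟨le_rfl, hτb⟩ ⟨hτb, le_rfl⟩ hτb
  by_cases h : ∃ s ∈ Icc a b, z s = zs
  · have hcl : IsClosed (Icc a b ∩ z ⁻¹' {zs}) :=
      (hz.continuousOn.mono fun s hs => ha.trans hs.1).preimage_isClosed_of_isClosed
        isClosed_Icc isClosed_singleton
    obtain ⟨τ, hτ, hmax⟩ := (isCompact_Icc.of_isClosed_subset hcl inter_subset_left).exists_isGreatest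
      (let ⟨s, hs, hs'⟩ := h; ⟨s, hs, hs'⟩)
    have h1 := main τ hτ.1.1 hτ.1.2 fun s hs hs' =>
      absurd (hmax ⟨⟨hτ.1.1.trans hs.1.le, hs.2.le⟩, hs'⟩) (not_le.2 hs.1)
    rw [show z τ = zs from hτ.2, sub_self, norm_zero] at h1
    exact h1.trans (norm_nonneg _)
  · push Not at h
    exact main a le_rfl hab fun s hs => h s ⟨hs.1.le, hs.2.le⟩

theorem IsCurveAwayFrom.eq_of_le (hz : IsCurveAwayFrom zs f z) (hf : IsDissipativeField zs f)
    {a b : ℝ} (ha : 0 ≤ a) (hab : a ≤ b) (h : z a = zs) : z b = zs := by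
  have h1 := hz.norm_le hf ha hab
  rw [h, sub_self, norm_zero] at h1
  exact sub_eq_zero.1 (norm_le_zero_iff.1 h1)

/-- The first time at which the curve reaches `zs`. -/
theorem IsCurveAwayFrom.exists_first (hz : IsCurveAwayFrom zs f z) {b : ℝ} (hb : 0 ≤ b)
    (h : z b = zs) : ∃ T, 0 ≤ T ∧ T ≤ b ∧ z T = zs ∧ ∀ s, 0 ≤ s → s < T → z s ≠ zs := by
  have hcl : IsClosed (Icc 0 b ∩ z ⁻¹' {zs}) :=
    (hz.continuousOn.mono Icc_subset_Ici_self).preimage_isClosed_of_isClosed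
      isClosed_Icc isClosed_singleton
  obtain ⟨T, hT, hmin⟩ := (isCompact_Icc.of_isClosed_subset hcl inter_subset_left).exists_isLeast
    ⟨b, ⟨hb, le_rfl⟩, h⟩
  exact ⟨T, hT.1.1, hT.1.2, hT.2, fun s hs hsT hs' =>
    absurd (hmin ⟨⟨hs, hsT.le.trans hT.1.2⟩, hs'⟩) (not_le.2 hsT)⟩

/-- The field may blow up at the hitting time `T`. It stays integrable because `norm_mul_le` bounds
it by a multiple of `-(d/dt)‖z - zs‖`, the derivative of a continuous monotone function. -/
theorem IsCurveAwayFrom.isSolution [CompleteSpace H] (hz : IsCurveAwayFrom zs f z)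
    (hf : IsDissipativeField zs f) : IsSolution f z := by
  intro t ht
  obtain ⟨T, hT0, hTt, hbef, haft⟩ : ∃ T, 0 ≤ T ∧ T ≤ t ∧ (∀ s, 0 ≤ s → s < T → z s ≠ zs) ∧
      ∀ s, T < s → s ≤ t → z s = zs := by
    by_cases h : z t = zs
    · obtain ⟨T, h1, h2, h3, h4⟩ := hz.exists_first ht h
      exact ⟨T, h1, h2, h4, fun s hs _ => hz.eq_of_le hf h1 hs.le h3⟩
    · exact ⟨t, ht, le_rfl, fun s hs hst hs' => h (hz.eq_of_le hf hs hst.le hs'),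
        fun s h1 h2 => absurd h1 (not_lt.2 h2)⟩
  obtain ⟨C, hC0, hC⟩ := hf.norm_mul_le
  have hi1 : IntegrableOn (fun s => -inner ℝ (z s - zs) (f (z s)) / ‖z s - zs‖) (Ioc 0 T) := by
    refine intervalIntegral.integrableOn_deriv_of_nonneg (g := fun s => -‖z s - zs‖)
      (hz.continuousOn_norm.neg.mono Icc_subset_Ici_self) (fun s hs => ?_) fun s _ =>
        div_nonneg (neg_nonneg.2 (hf.inner_nonpos _)) (norm_nonneg _)
    have hne := hbef s hs.1.le hs.2
    have hp : 0 < ‖z s - zs‖ := norm_pos_iff.2 (sub_ne_zero.2 hne)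
    have h1 := ((hz.hasDerivAt_norm_sq hs.1 hne).sqrt (by positivity)).neg
    simp only [Real.sqrt_sq (norm_nonneg _)] at h1
    rwa [mul_div_mul_left _ _ two_ne_zero, ← neg_div] at h1
  have hi2 : IntegrableOn (fun s => f (z s)) (Ioc 0 T) := by
    refine (hi1.const_mul C).mono' ?_ (Eventually.of_forall fun s => ?_)
    · rw [Measure.restrict_congr_set Ioo_ae_eq_Ioc.symm]
      refine ContinuousOn.aestronglyMeasurable (fun s hs => ?_) measurableSet_Ioo
      exact ((hf.continuousAt (hbef s hs.1.le hs.2)).comp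
        (hz.hasDerivAt hs.1 (hbef s hs.1.le hs.2)).continuousAt).continuousWithinAt
    · by_cases h : z s = zs
      · simp [h, hf.zero]
      · have hp : 0 < ‖z s - zs‖ := norm_pos_iff.2 (sub_ne_zero.2 h)
        rw [← mul_div_assoc, le_div_iff₀ hp]
        exact hC _
  have hi3 : IntervalIntegrable (fun s => f (z s)) volume T t := by
    refine (intervalIntegrable_const (c := (0 : H))).congr fun s hs => ?_
    rw [uIoc_of_le hTt] at hs
    simp [haft s hs.1 hs.2, hf.zero]
  have hi : IntervalIntegrable (fun s => f (z s)) volume 0 t :=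
    ((intervalIntegrable_iff_integrableOn_Ioc_of_le hT0).2 hi2).trans hi3
  refine ⟨hi, ?_⟩
  -- The curve need not be differentiable at `T`, so that one point is excepted.
  rw [integral_eq_of_hasDerivAt_off_countable_of_le z _ ht (countable_singleton T)
    (hz.continuousOn.mono Icc_subset_Ici_self) (fun s hs => ?_) hi]
  · abel
  · rcases lt_or_gt_of_ne hs.2 with h | h
    · exact hz.hasDerivAt hs.1.1 (hbef s hs.1.1.le h)
    · rw [haft s h hs.1.2.le, hf.zero]
      refine (hasDerivAt_const s zs).congr_of_eventuallyEq ?_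
      filter_upwards [Ioo_mem_nhds h hs.1.2] with u hu
      exact haft u hu.1 hu.2.le

/-- Distances to `zs` are nonincreasing, so up to time `b` both curves stay in one annulus, where
the field is Lipschitz. -/
theorem IsCurveAwayFrom.eq_of_ne (hf : IsDissipativeField zs f) (hz : IsCurveAwayFrom zs f z)
    (hy : IsCurveAwayFrom zs f y) (h0 : z 0 = y 0) {b : ℝ} (hb : 0 ≤ b) (hzb : z b ≠ zs)
    (hyb : y b ≠ zs) : z b = y b := by
  set δ := min ‖z b - zs‖ ‖y b - zs‖ with hδ
  have hδ0 : 0 < δ :=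
    lt_min (norm_pos_iff.2 (sub_ne_zero.2 hzb)) (norm_pos_iff.2 (sub_ne_zero.2 hyb))
  obtain ⟨K, hK⟩ := hf.lipschitz δ ‖z 0 - zs‖ hδ0
  refine ODE_solution_unique_of_mem_Icc_right (v := fun _ => f) (a := 0) (b := b)
    (s := fun _ => {x | δ ≤ ‖x - zs‖ ∧ ‖x - zs‖ ≤ ‖z 0 - zs‖}) (fun _ _ => hK)
    (hz.continuousOn.mono Icc_subset_Ici_self) (fun t ht => ?_) (fun t ht => ?_)
    (hy.continuousOn.mono Icc_subset_Ici_self) (fun t ht => ?_) (fun t ht => ?_) h0 ⟨hb, le_rfl⟩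
  · exact (hz.hasDerivWithinAt t ht.1 fun h => hzb (hz.eq_of_le hf ht.1 ht.2.le h)).mono
      (Ici_subset_Ici.2 ht.1)
  · exact ⟨(min_le_left _ _).trans (hz.norm_le hf ht.1 ht.2.le), hz.norm_le hf le_rfl ht.1⟩
  · exact (hy.hasDerivWithinAt t ht.1 fun h => hyb (hy.eq_of_le hf ht.1 ht.2.le h)).mono
      (Ici_subset_Ici.2 ht.1)
  · refine ⟨(min_le_right _ _).trans (hy.norm_le hf ht.1 ht.2.le), ?_⟩
    rw [h0]
    exact hy.norm_le hf le_rfl ht.1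

/-- Otherwise the curves agree before the first hitting time `T` of `z`, hence at `T` by continuity,
and `y` would be absorbed there too. -/
theorem IsCurveAwayFrom.eq_target (hf : IsDissipativeField zs f) (hz : IsCurveAwayFrom zs f z)
    (hy : IsCurveAwayFrom zs f y) (h0 : z 0 = y 0) {b : ℝ} (hb : 0 ≤ b) (hzb : z b = zs) :
    y b = zs := by
  by_contra hyb
  obtain ⟨T, hT0, hTb, hT, hbef⟩ := hz.exists_first hb hzb
  have hyT : y T ≠ zs := fun h => hyb (hy.eq_of_le hf hT0 hTb h)
  rcases hT0.eq_or_lt with rfl | hT0'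
  · exact hyT (h0 ▸ hT)
  · have h1 : EqOn z y (Ico 0 T) := fun s hs => IsCurveAwayFrom.eq_of_ne hf hz hy h0 hs.1 (hbef s hs.1 hs.2)
      fun h => hyT (hy.eq_of_le hf hs.1 hs.2.le h)
    have h2 : EqOn z y (Icc 0 T) := h1.of_subset_closure
      (hz.continuousOn.mono Icc_subset_Ici_self) (hy.continuousOn.mono Icc_subset_Ici_self)
      Ico_subset_Icc_self (closure_Ico hT0'.ne).ge
    exact hyT ((h2 ⟨hT0, le_rfl⟩).symm.trans hT)

theorem IsCurveAwayFrom.unique (hf : IsDissipativeField zs f) (hz : IsCurveAwayFrom zs f z)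
    (hy : IsCurveAwayFrom zs f y) (h0 : z 0 = y 0) {t : ℝ} (ht : 0 ≤ t) : z t = y t := by
  by_cases h1 : z t = zs
  · rw [h1, IsCurveAwayFrom.eq_target hf hz hy h0 ht h1]
  · by_cases h2 : y t = zs
    · exact absurd (IsCurveAwayFrom.eq_target hf hy hz h0.symm ht h2) h1
    · exact IsCurveAwayFrom.eq_of_ne hf hz hy h0 ht h1 h2

end Dissipative

/-! ### Global integral curves of bounded Lipschitz fields. -/

section GlobalCurve

open Set Filter Topology

variable {E : Type*} [NormedAddCommGroup E] [NormedSpace ℝ E]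

/-- A bounded Lipschitz field on a Banach space has global integral curves. -/
theorem exists_forall_hasDerivAt_of_lipschitzWith_of_bounded [CompleteSpace E] {g : E → E}
    {K C : ℝ≥0} (hg : LipschitzWith K g) (hC : ∀ x, ‖g x‖ ≤ C) (x₀ : E) :
    ∃ y : ℝ → E, y 0 = x₀ ∧ ∀ t, HasDerivAt y (g (y t)) t := by
  have hloc : ∀ n : ℕ, ∃ α : ℝ → E, α 0 = x₀ ∧ ∀ t ∈ Ioo (-(n : ℝ)) n,
      HasDerivAt α (g (α t)) t := by
    intro n
    have hn : (0 : ℝ) ∈ Icc (-(n : ℝ)) n := by simp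
    -- A field bounded by `C` moves a point at most `C * n` in time `n`, so Picard–Lindelöf works on
    -- all of `[-n, n]`.
    have hpl : IsPicardLindelof (fun _ : ℝ => g) (⟨0, hn⟩ : Icc (-(n : ℝ)) n) x₀
        (C * n) 0 C K :=
      ⟨fun _ _ => hg.lipschitzOnWith, fun _ _ => continuousOn_const, fun _ _ x _ => hC x,
        by simp⟩
    obtain ⟨α, h0, hα⟩ := hpl.exists_eq_forall_mem_Icc_hasDerivWithinAt₀
    exact ⟨α, h0, fun t ht => (hα t (Ioo_subset_Icc_self ht)).hasDerivAt (Icc_mem_nhds ht.1 ht.2)⟩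
  choose α h0 hα using hloc
  have hagree : ∀ m n : ℕ, m ≤ n → ∀ t : ℝ, |t| < m → α m t = α n t := by
    intro m n hmn t ht
    have hmn' : (m : ℝ) ≤ n := by exact_mod_cast hmn
    have ht' := abs_lt.1 ht
    refine ODE_solution_unique_of_mem_Ioo (v := fun _ => g) (s := fun _ => univ) (t₀ := 0)
      (a := -(m : ℝ)) (b := m)
      (fun _ _ => hg.lipschitzOnWith) (by constructor <;> linarith [abs_nonneg t])
      (fun s hs => ⟨hα m s hs, mem_univ _⟩)
      (fun s hs => ⟨hα n s ⟨by linarith [hs.1], by linarith [hs.2]⟩, mem_univ _⟩)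
      ((h0 m).trans (h0 n).symm) ht'
  -- The `+ 1` makes `t` an interior point of the interval of the chosen local solution.
  refine ⟨fun t => α (⌈|t|⌉₊ + 1) t, h0 _, fun t => ?_⟩
  have hlt : |t| < (⌈|t|⌉₊ + 1 : ℕ) := by
    push_cast
    linarith [Nat.le_ceil |t|]
  have h1 : (fun s => α (⌈|s|⌉₊ + 1) s) =ᶠ[𝓝 t] α (⌈|t|⌉₊ + 1) := by
    filter_upwards [continuous_abs.continuousAt.eventually (Iio_mem_nhds hlt)] with s hs
    rcases le_total ⌈|s|⌉₊ ⌈|t|⌉₊ with h | h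
    · refine hagree _ _ (by omega) s ?_
      push_cast
      linarith [Nat.le_ceil |s|]
    · exact (hagree _ _ (by omega) s hs).symm
  exact (hα _ t (abs_lt.1 hlt)).congr_of_eventuallyEq h1

theorem norm_inv_one_add_norm_smul_sub_le (v w : E) :
    ‖(1 + ‖v‖)⁻¹ • v - (1 + ‖w‖)⁻¹ • w‖ ≤ 2 * ‖v - w‖ := by
  have hv : 0 < 1 + ‖v‖ := by positivity
  have hw : 0 < 1 + ‖w‖ := by positivity
  have e : (1 + ‖v‖)⁻¹ • v - (1 + ‖w‖)⁻¹ • w =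
      (1 + ‖v‖)⁻¹ • (v - w) + ((1 + ‖v‖)⁻¹ * (‖w‖ - ‖v‖) * (1 + ‖w‖)⁻¹) • w := by
    have : (1 + ‖v‖)⁻¹ * (‖w‖ - ‖v‖) * (1 + ‖w‖)⁻¹ = (1 + ‖v‖)⁻¹ - (1 + ‖w‖)⁻¹ := by
      field_simp
      ring
    rw [this]
    module
  have h1 : (1 + ‖v‖)⁻¹ ≤ 1 := inv_le_one_of_one_le₀ (by linarith [norm_nonneg v])
  have h2 : (1 + ‖w‖)⁻¹ * ‖w‖ ≤ 1 := by
    rw [inv_mul_le_iff₀ hw]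
    linarith
  have h3 : ‖(1 + ‖v‖)⁻¹ • (v - w)‖ ≤ ‖v - w‖ := by
    rw [norm_smul, Real.norm_of_nonneg (by positivity)]
    exact mul_le_of_le_one_left (norm_nonneg _) h1
  have h4 : ‖((1 + ‖v‖)⁻¹ * (‖w‖ - ‖v‖) * (1 + ‖w‖)⁻¹) • w‖ ≤ ‖v - w‖ := by
    rw [norm_smul, norm_mul, norm_mul, Real.norm_of_nonneg (by positivity : 0 ≤ (1 + ‖v‖)⁻¹),
      Real.norm_of_nonneg (by positivity : 0 ≤ (1 + ‖w‖)⁻¹), mul_assoc]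
    have h5 : ‖‖w‖ - ‖v‖‖ ≤ ‖v - w‖ := by
      rw [norm_sub_rev]
      exact abs_norm_sub_norm_le v w
    calc (1 + ‖v‖)⁻¹ * ‖‖w‖ - ‖v‖‖ * ((1 + ‖w‖)⁻¹ * ‖w‖) ≤ 1 * ‖v - w‖ * 1 := by gcongr
      _ = ‖v - w‖ := by ring
  rw [e]
  linarith [norm_add_le ((1 + ‖v‖)⁻¹ • (v - w))
    (((1 + ‖v‖)⁻¹ * (‖w‖ - ‖v‖) * (1 + ‖w‖)⁻¹) • w)]

end GlobalCurve

/-! ### Existence by time change, and well-posedness. -/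

section Existence

open Set Filter Topology

variable {H : Type*} [NormedAddCommGroup H] [InnerProductSpace ℝ H] {c : ℝ} {zs : H} {Φ : H → H}
  {ψ : ℝ → ℝ}

theorem IsResidualLike.isDissipativeField (h : IsResidualLike c zs Φ)
    (hψ : ∀ ρ, 0 < ρ → 0 < ψ ρ)
    (hψL : ∀ a b, 0 < a → ∃ K : ℝ≥0, LipschitzOnWith K ψ (Icc a b)) :
    IsDissipativeField zs (fun x => -(ψ ‖Φ x‖) • Φ x) := by
  have hc1 : 0 < 1 - c := sub_pos.2 h.lt_one
  have hc2 : 0 < 1 + c := by linarith [h.pos]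
  have hψΦ : ∀ x, Φ x ≠ 0 → 0 < ψ ‖Φ x‖ := fun x hx => hψ _ (norm_pos_iff.2 hx)
  have hin : ∀ x, 0 ≤ inner ℝ (x - zs) (Φ x) := fun x =>
    le_trans (by positivity) (h.inner_ge x)
  refine ⟨by simp [(h.eq_zero_iff zs).2 rfl], fun x => ?_, fun δ R hδ => ?_, ?_⟩
  · by_cases hx : Φ x = 0
    · simp [hx]
    · rw [real_inner_smul_right]
      nlinarith [mul_nonneg (hψΦ x hx).le (hin x)]
  · obtain ⟨K, hK⟩ := hψL ((1 - c) * δ) ((1 + c) * R) (by positivity)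
    obtain ⟨M, hM⟩ := isCompact_Icc.exists_bound_of_continuousOn hK.continuousOn
    have hmem : ∀ x ∈ {x | δ ≤ ‖x - zs‖ ∧ ‖x - zs‖ ≤ R},
        ‖Φ x‖ ∈ Icc ((1 - c) * δ) ((1 + c) * R) := fun x hx =>
      ⟨(mul_le_mul_of_nonneg_left hx.1 hc1.le).trans (h.norm_ge x),
        (h.norm_le x).trans (mul_le_mul_of_nonneg_left hx.2 hc2.le)⟩
    -- Product rule for `ψ(‖Φ‖) Φ`: `M` bounds `ψ(‖Φ‖)` and `(1 + c) * R` bounds `‖Φ‖` on the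
    -- annulus.
    refine ⟨(M * (1 + c) + K * (1 + c) * ((1 + c) * R)).toNNReal,
      LipschitzOnWith.of_dist_le_mul fun x hx y hy => ?_⟩
    have h1 : ‖ψ ‖Φ x‖ - ψ ‖Φ y‖‖ ≤ K * ((1 + c) * ‖x - y‖) := by
      have h2 := hK.dist_le_mul _ (hmem x hx) _ (hmem y hy)
      rw [dist_eq_norm, dist_eq_norm] at h2
      refine h2.trans (mul_le_mul_of_nonneg_left ?_ K.2)
      exact (abs_norm_sub_norm_le _ _).trans (h.lipschitz x y)
    have e : -(ψ ‖Φ x‖) • Φ x - -(ψ ‖Φ y‖) • Φ y =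
        -((ψ ‖Φ x‖) • (Φ x - Φ y) + (ψ ‖Φ x‖ - ψ ‖Φ y‖) • Φ y) := by module
    rw [dist_eq_norm, dist_eq_norm, e, norm_neg]
    calc _ ≤ ‖ψ ‖Φ x‖‖ * ‖Φ x - Φ y‖ + ‖ψ ‖Φ x‖ - ψ ‖Φ y‖‖ * ‖Φ y‖ := by
          refine (norm_add_le _ _).trans_eq ?_
          rw [norm_smul, norm_smul]
      _ ≤ M * ((1 + c) * ‖x - y‖) + K * ((1 + c) * ‖x - y‖) * ((1 + c) * R) := by
          gcongr
          · exact (norm_nonneg _).trans (hM _ (hmem x hx))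
          · exact hM _ (hmem x hx)
          · exact h.lipschitz x y
          · exact (hmem y hy).2
      _ = (M * (1 + c) + K * (1 + c) * ((1 + c) * R)) * ‖x - y‖ := by ring
      _ ≤ _ := by
          gcongr
          exact Real.le_coe_toNNReal _
  -- The angle between `Φ x` and `x - zs` has cosine at least `(1 - c) / (1 + c)`.
  · refine ⟨(1 + c) / (1 - c), by positivity, fun x => ?_⟩
    by_cases hx : Φ x = 0
    · simp [hx]
    · have hp := hψΦ x hx
      rw [norm_smul, norm_neg, Real.norm_of_nonneg hp.le, real_inner_smul_right, neg_mul, neg_neg,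
        mul_left_comm, mul_assoc]
      refine mul_le_mul_of_nonneg_left ?_ hp.le
      rw [div_mul_eq_mul_div, le_div_iff₀ hc1]
      calc ‖Φ x‖ * ‖x - zs‖ * (1 - c) ≤ (1 + c) * ‖x - zs‖ * ‖x - zs‖ * (1 - c) := by
            gcongr
            exact h.norm_le x
        _ = (1 + c) * ((1 - c) * ‖x - zs‖ ^ 2) := by ring
        _ ≤ _ := mul_le_mul_of_nonneg_left (h.inner_ge x) hc2.le

theorem IsResidualLike.exists_lipschitzWith (h : IsResidualLike c zs Φ) :
    ∃ K : ℝ≥0, LipschitzWith K fun x => -((1 + ‖Φ x‖)⁻¹ • Φ x) := by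
  have hc2 : 0 ≤ 1 + c := by linarith [h.pos]
  refine ⟨⟨2 * (1 + c), by positivity⟩, LipschitzWith.of_dist_le_mul fun x y => ?_⟩
  rw [dist_neg_neg, dist_eq_norm, dist_eq_norm]
  calc _ ≤ 2 * ‖Φ x - Φ y‖ := norm_inv_one_add_norm_smul_sub_le _ _
    _ ≤ 2 * ((1 + c) * ‖x - y‖) := by gcongr; exact h.lipschitz x y
    _ = _ := by rw [← mul_assoc]; rfl

/-- The time-changed flow `ẏ = -Φ(y) / (1 + ‖Φ(y)‖)`. -/
theorem IsResidualLike.exists_curve [CompleteSpace H] (h : IsResidualLike c zs Φ) (x₀ : H) :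
    ∃ y : ℝ → H, y 0 = x₀ ∧ ∀ t, HasDerivAt y (-((1 + ‖Φ (y t)‖)⁻¹ • Φ (y t))) t := by
  obtain ⟨K, hL⟩ := h.exists_lipschitzWith
  refine exists_forall_hasDerivAt_of_lipschitzWith_of_bounded (C := 1) hL (fun x => ?_) x₀
  rw [norm_neg, norm_smul, Real.norm_of_nonneg (by positivity), inv_mul_le_iff₀ (by positivity)]
  rw [NNReal.coe_one]
  linarith

/-- The constant curve `zs` solves the same Lipschitz equation, and uniqueness also holds backwards
in time. -/
theorem IsResidualLike.curve_ne (h : IsResidualLike c zs Φ) {y : ℝ → H}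
    (hy : ∀ t, HasDerivAt y (-((1 + ‖Φ (y t)‖)⁻¹ • Φ (y t))) t) (h0 : y 0 ≠ zs) (t : ℝ) :
    y t ≠ zs := by
  intro ht
  obtain ⟨K, hL⟩ := h.exists_lipschitzWith
  have h1 : y = fun _ => zs := by
    refine ODE_solution_unique_univ (v := fun _ x => -((1 + ‖Φ x‖)⁻¹ • Φ x)) (s := fun _ => univ)
      (t₀ := t) (fun _ => hL.lipschitzOnWith) (fun s => ⟨hy s, mem_univ _⟩) (fun s => ⟨?_, mem_univ _⟩) ht
    simpa [(h.eq_zero_iff zs).2 rfl] using hasDerivAt_const s zs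
  exact h0 (congrFun h1 0)

theorem IsResidualLike.tendsto_curve (h : IsResidualLike c zs Φ) {y : ℝ → H}
    (hy : ∀ t, HasDerivAt y (-((1 + ‖Φ (y t)‖)⁻¹ • Φ (y t))) t) : Tendsto y atTop (𝓝 zs) := by
  have hc1 : 0 < 1 - c := sub_pos.2 h.lt_one
  have hc2 : 0 < 1 + c := by linarith [h.pos]
  set v : ℝ → ℝ := fun t => ‖y t - zs‖ ^ 2 with hv
  have hvd : ∀ t, HasDerivAt v (2 * inner ℝ (y t - zs) (-((1 + ‖Φ (y t)‖)⁻¹ • Φ (y t)))) t :=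
    fun t => ((hy t).sub_const zs).norm_sq
  have hin : ∀ t, 2 * inner ℝ (y t - zs) (-((1 + ‖Φ (y t)‖)⁻¹ • Φ (y t))) ≤
      -(2 * ((1 + ‖Φ (y t)‖)⁻¹ * ((1 - c) * v t))) := by
    intro t
    rw [inner_neg_right, real_inner_smul_right]
    have := mul_le_mul_of_nonneg_left (h.inner_ge (y t))
      (by positivity : 0 ≤ (1 + ‖Φ (y t)‖)⁻¹)
    linarith
  have hanti : Antitone v := by
    refine antitone_of_deriv_nonpos (fun t => (hvd t).differentiableAt) fun t => ?_
    rw [(hvd t).deriv]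
    refine (hin t).trans (neg_nonpos.2 ?_)
    positivity
  -- An exponential decay rate for `v`: along the curve `‖Φ‖` never exceeds `(1 + c)‖y 0 - zs‖` for
  -- positive times.
  set k : ℝ := 2 * ((1 + (1 + c) * ‖y 0 - zs‖)⁻¹ * (1 - c)) with hk
  have hk0 : 0 < k := by positivity
  have hw : AntitoneOn (fun t => v t * Real.exp (k * t)) (Ici 0) := by
    have hd : ∀ t, HasDerivAt (fun t => v t * Real.exp (k * t))
        (2 * inner ℝ (y t - zs) (-((1 + ‖Φ (y t)‖)⁻¹ • Φ (y t))) * Real.exp (k * t) +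
          v t * (Real.exp (k * t) * k)) t := fun t => by
      have he : HasDerivAt (fun t => Real.exp (k * t)) (Real.exp (k * t) * k) t := by
        simpa using ((hasDerivAt_id t).const_mul k).exp
      exact (hvd t).mul he
    refine antitoneOn_of_hasDerivWithinAt_nonpos (convex_Ici 0)
      (fun t _ => (hd t).continuousAt.continuousWithinAt)
      (fun t _ => (hd t).hasDerivWithinAt) fun t ht => ?_
    rw [interior_Ici] at ht
    have h1 : ‖Φ (y t)‖ ≤ (1 + c) * ‖y 0 - zs‖ := by
      refine (h.norm_le _).trans (mul_le_mul_of_nonneg_left ?_ hc2.le)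
      exact le_of_sq_le_sq (hanti (le_of_lt ht)) (norm_nonneg _)
    have h2 : k * v t ≤ 2 * ((1 + ‖Φ (y t)‖)⁻¹ * ((1 - c) * v t)) := by
      have h3 : (1 + (1 + c) * ‖y 0 - zs‖)⁻¹ ≤ (1 + ‖Φ (y t)‖)⁻¹ := by gcongr
      have h4 : 0 ≤ (1 - c) * v t := by positivity
      have h5 := mul_le_mul_of_nonneg_right h3 h4
      rw [hk]
      linarith
    have h6 := mul_nonneg (Real.exp_pos (k * t)).le
      (sub_nonneg.2 ((hin t).trans (neg_le_neg h2)))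
    linarith
  have hlim : Tendsto v atTop (𝓝 0) := by
    have h1 : Tendsto (fun t => v 0 * Real.exp (-(k * t))) atTop (𝓝 (v 0 * 0)) :=
      (Real.tendsto_exp_neg_atTop_nhds_zero.comp
        (tendsto_id.const_mul_atTop hk0)).const_mul _
    rw [mul_zero] at h1
    refine squeeze_zero' (Eventually.of_forall fun t => by positivity) ?_ h1
    filter_upwards [eventually_ge_atTop 0] with t ht
    have h2 := hw (mem_Ici.2 le_rfl) (mem_Ici.2 ht) ht
    simp only [mul_zero, Real.exp_zero, mul_one] at h2
    rw [Real.exp_neg, ← div_eq_mul_inv, le_div_iff₀ (Real.exp_pos _)]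
    exact h2
  rw [tendsto_iff_norm_sub_tendsto_zero]
  have h3 := hlim.sqrt
  simpa [hv, Real.sqrt_sq (norm_nonneg _)] using h3

-- The field is `ψ(‖Φ‖)(1 + ‖Φ‖)` times `-Φ / (1 + ‖Φ‖)`. The curve of the latter is run with the
-- clock `θ = ∫ q`, where `q` is the inverse of that factor. If `θ` is bounded above, the supremum
-- is the arrival time at `zs`, and the value `zs` is used from then on.
open Classical in
theorem IsResidualLike.exists_isCurveAwayFrom [CompleteSpace H] (h : IsResidualLike c zs Φ)
    (hψ : ∀ ρ, 0 < ρ → 0 < ψ ρ) (hψc : ContinuousOn ψ (Ioi 0)) (x₀ : H) :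
    ∃ z : ℝ → H, IsCurveAwayFrom zs (fun x => -(ψ ‖Φ x‖) • Φ x) z ∧ z 0 = x₀ := by
  by_cases hx₀ : x₀ = zs
  · exact ⟨fun _ => zs, ⟨continuousOn_const, fun t _ hne => absurd rfl hne⟩, hx₀.symm⟩
  have hΦc : Continuous Φ := by
    have hc2 : 0 ≤ 1 + c := by linarith [h.pos]
    refine LipschitzWith.continuous (K := ⟨1 + c, hc2⟩) (LipschitzWith.of_dist_le_mul fun x y => ?_)
    rw [dist_eq_norm, dist_eq_norm]
    exact h.lipschitz x y
  obtain ⟨y, hy0, hy⟩ := h.exists_curve x₀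
  have hne : ∀ t, y t ≠ zs := h.curve_ne hy (hy0 ▸ hx₀)
  have hyc : Continuous y := continuous_iff_continuousAt.2 fun t => (hy t).continuousAt
  have hΦpos : ∀ t, 0 < ‖Φ (y t)‖ := fun t =>
    norm_pos_iff.2 fun h' => hne t ((h.eq_zero_iff _).1 h')
  have hlim := h.tendsto_curve hy
  set q : ℝ → ℝ := fun t => (ψ ‖Φ (y t)‖ * (1 + ‖Φ (y t)‖))⁻¹ with hq
  have hden : ∀ t, 0 < ψ ‖Φ (y t)‖ * (1 + ‖Φ (y t)‖) := fun t =>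
    mul_pos (hψ _ (hΦpos t)) (by positivity)
  have hq0 : ∀ t, 0 < q t := fun t => inv_pos.2 (hden t)
  have hqc : Continuous q := by
    refine Continuous.inv₀ (Continuous.mul ?_ (by fun_prop)) fun t => (hden t).ne'
    exact hψc.comp_continuous (hΦc.comp hyc).norm hΦpos
  set θ : ℝ → ℝ := fun t => ∫ s in (0 : ℝ)..t, q s with hθ
  have hθd : ∀ t, HasStrictDerivAt θ (q t) t := fun t =>
    intervalIntegral.integral_hasStrictDerivAt_right (hqc.intervalIntegrable _ _)
      (hqc.stronglyMeasurableAtFilter _ _) hqc.continuousAt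
  have hθm : StrictMono θ := strictMono_of_hasDerivAt_pos (fun t => (hθd t).hasDerivAt) hq0
  have hθ0 : θ 0 = 0 := intervalIntegral.integral_same
  have hθc : Continuous θ := continuous_iff_continuousAt.2 fun t => (hθd t).hasDerivAt.continuousAt
  set σ : ℝ → ℝ := Function.invFun θ with hσ
  have hσθ : ∀ t, σ (θ t) = t := Function.leftInverse_invFun hθm.injective
  set z : ℝ → H := fun t => if t ∈ range θ then y (σ t) else zs with hz
  have hzθ : ∀ t, z (θ t) = y t := fun t => by
    simp only [hz, if_pos (mem_range_self t), hσθ]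
  have hzd : ∀ t, HasDerivAt z (-(ψ ‖Φ (z (θ t))‖) • Φ (z (θ t))) (θ t) := by
    intro t
    have h1 : HasDerivAt σ (q t)⁻¹ (θ t) :=
      ((hθd t).to_local_left_inverse (hq0 t).ne' (Eventually.of_forall hσθ)).hasDerivAt
    have h2 := HasDerivAt.scomp (θ t) (by rw [hσθ]; exact hy t) h1
    have h3 : z =ᶠ[𝓝 (θ t)] y ∘ σ := by
      have : range θ ∈ 𝓝 (θ t) := by
        rw [← (hθd t).map_nhds_eq (hq0 t).ne']
        exact range_mem_map
      filter_upwards [this] with s hs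
      simp only [hz, if_pos hs, Function.comp]
    convert h2.congr_of_eventuallyEq h3 using 1
    rw [hzθ]
    simp only [hq, inv_inv]
    rw [smul_neg, smul_smul, mul_assoc, mul_inv_cancel₀ (by positivity), mul_one, neg_smul]
  refine ⟨z, ⟨fun t ht => ?_, fun t ht hzt => ?_⟩, ?_⟩
  · by_cases htr : t ∈ range θ
    · obtain ⟨τ, rfl⟩ := htr
      exact (hzd τ).continuousAt.continuousWithinAt
    -- Here `t ≥ 0 = θ 0` lies above the whole range of `θ`; times close to `t` are either outside
    -- the range or come from large parameters, where `y` is near `zs`.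
    · refine ContinuousAt.continuousWithinAt ?_
      have hzt : z t = zs := if_neg htr
      rw [Metric.continuousAt_iff']
      intro ε hε
      rw [hzt]
      obtain ⟨τ₀, hτ₀⟩ := eventually_atTop.1 (Metric.tendsto_nhds.1 hlim ε hε)
      have hlt : θ τ₀ < t := by
        by_contra hle
        exact htr (mem_range_of_exists_le_of_exists_ge hθc ⟨0, hθ0.trans_le ht⟩ ⟨τ₀, not_lt.1 hle⟩)
      filter_upwards [Ioi_mem_nhds hlt] with s hs
      by_cases hsr : s ∈ range θ
      · obtain ⟨τ, rfl⟩ := hsr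
        rw [hzθ]
        exact hτ₀ τ (hθm.lt_iff_lt.1 hs).le
      · rw [show z s = zs from if_neg hsr, dist_self]
        exact hε
  · by_cases htr : t ∈ range θ
    · obtain ⟨τ, rfl⟩ := htr
      exact (hzd τ).hasDerivWithinAt
    · exact absurd (if_neg htr) hzt
  · rw [← hθ0, hzθ, hy0]

theorem IsResidualLike.isWellPosed [CompleteSpace H] (h : IsResidualLike c zs Φ)
    (hψ : ∀ ρ, 0 < ρ → 0 < ψ ρ)
    (hψL : ∀ a b, 0 < a → ∃ K : ℝ≥0, LipschitzOnWith K ψ (Icc a b)) :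
    IsWellPosed (fun x => -(ψ ‖Φ x‖) • Φ x) := by
  have hf := h.isDissipativeField hψ hψL
  have hψc : ContinuousOn ψ (Ioi 0) := fun ρ hρ => by
    have hρ' : (0 : ℝ) < ρ := hρ
    obtain ⟨K, hK⟩ := hψL (ρ / 2) (ρ + 1) (by positivity)
    exact (hK.continuousOn.continuousAt
      (Icc_mem_nhds (by linarith) (by linarith))).continuousWithinAt
  refine ⟨fun x₀ => ?_, fun z y hz hy h0 t ht =>
    IsCurveAwayFrom.unique hf (hf.isCurveAwayFrom hz) (hf.isCurveAwayFrom hy) h0 ht⟩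
  obtain ⟨z, hz, hz0⟩ := h.exists_isCurveAwayFrom hψ hψc x₀
  exact ⟨z, hz.isSolution hf, hz0⟩

end Existence

/-! ### Scalar differential inequalities and extinction times. -/

section Decay

open Set

/-- A nonnegative nonincreasing function with `V' ≤ -D(V)` as long as it is positive. -/
structure IsDecaying (D V : ℝ → ℝ) : Prop where
  continuousOn : ContinuousOn V (Ici 0)
  antitoneOn : AntitoneOn V (Ici 0)
  nonneg : ∀ t, 0 ≤ V t
  deriv_le : ∀ t, 0 < t → 0 < V t → ∃ V', HasDerivAt V V' t ∧ V' ≤ -D (V t)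

variable {D V : ℝ → ℝ}

/-- Separation of variables: with `W' ≥ 1 / D`, the function `W(V t) + t` is nonincreasing. -/
theorem IsDecaying.sub_le (h : IsDecaying D V) {W W' : ℝ → ℝ} {a b : ℝ} (ha : 0 ≤ a)
    (hab : a ≤ b) (hb : 0 < V b)
    (hW : ∀ v, V b ≤ v → v ≤ V a → HasDerivAt W (W' v) v ∧ 0 ≤ W' v ∧ 1 ≤ W' v * D v) :
    b - a ≤ W (V a) - W (V b) := by
  have hmem : ∀ t ∈ Icc a b, V b ≤ V t ∧ V t ≤ V a := fun t ht =>
    ⟨h.antitoneOn (ha.trans ht.1) (ha.trans hab) ht.2, h.antitoneOn ha (ha.trans ht.1) ht.1⟩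
  choose! V' hV' using h.deriv_le
  have hanti : AntitoneOn (fun t => W (V t) + t) (Icc a b) := by
    refine antitoneOn_of_hasDerivWithinAt_nonpos (convex_Icc a b)
      (f' := fun t => W' (V t) * V' t + 1) (fun t ht => ?_) (fun t ht => ?_) (fun t ht => ?_)
    · have h1 := (hW _ (hmem t ht).1 (hmem t ht).2).1.continuousAt
      refine (h1.comp_continuousWithinAt ?_).add continuousWithinAt_id
      exact (h.continuousOn t (ha.trans ht.1)).mono fun s hs => ha.trans hs.1
    all_goals
      rw [interior_Icc] at ht
      have ht' := hmem t (Ioo_subset_Icc_self ht)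
      have h1 := hW _ ht'.1 ht'.2
      have h2 := hV' t (ha.trans_lt ht.1) (hb.trans_le ht'.1)
    · exact ((h1.1.comp t h2.1).add (hasDerivAt_id t)).hasDerivWithinAt
    · have h3 := mul_le_mul_of_nonneg_left h2.2 h1.2.1
      linarith [h1.2.2]
  have h1 := hanti ⟨le_rfl, hab⟩ ⟨hab, le_rfl⟩ hab
  simp only at h1
  linarith

theorem IsDecaying.eq_zero_of_le (h : IsDecaying D V) {a t : ℝ} (ha : 0 ≤ a) (h0 : V a = 0)
    (hat : a ≤ t) : V t = 0 :=
  le_antisymm (h0 ▸ h.antitoneOn ha (ha.trans hat) hat) (h.nonneg t)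

theorem IsDecaying.eq_zero (h : IsDecaying D V) {W W' : ℝ → ℝ} {T : ℝ} (hT : 0 ≤ T)
    (hW : ∀ v, 0 < v → HasDerivAt W (W' v) v ∧ 0 ≤ W' v ∧ 1 ≤ W' v * D v)
    (hWT : ∀ v, 0 < v → 0 < W v ∧ W v ≤ T) {t : ℝ} (ht : T ≤ t) : V t = 0 := by
  refine h.eq_zero_of_le hT ?_ ht
  by_contra hne
  have hpos : 0 < V T := lt_of_le_of_ne (h.nonneg T) (Ne.symm hne)
  have h1 := h.sub_le le_rfl hT hpos fun v hv _ => hW v (hpos.trans_le hv)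
  have h2 := hWT (V 0) (hpos.trans_le (h.antitoneOn (mem_Ici.2 le_rfl) hT hT))
  linarith [(hWT (V T) hpos).1, h2.2]

/-- Comparison in two phases: `V ≥ 1` lasts at most `T₂`, and `0 < V ≤ 1` at most `T₁`. -/
theorem IsDecaying.eq_zero_of_two_phases (h : IsDecaying D V) {W₁ W₁' W₂ W₂' : ℝ → ℝ}
    {T₁ T₂ : ℝ} (hT₁ : 0 ≤ T₁) (hT₂ : 0 ≤ T₂)
    (hW₁ : ∀ v, 0 < v → HasDerivAt W₁ (W₁' v) v ∧ 0 ≤ W₁' v ∧ 1 ≤ W₁' v * D v)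
    (hWT₁ : ∀ v, 0 < v → v ≤ 1 → 0 < W₁ v ∧ W₁ v ≤ T₁)
    (hW₂ : ∀ v, 0 < v → HasDerivAt W₂ (W₂' v) v ∧ 0 ≤ W₂' v ∧ 1 ≤ W₂' v * D v)
    (hWT₂ : ∀ v, 1 ≤ v → W₂ v < 0 ∧ -T₂ ≤ W₂ v) {t : ℝ} (ht : T₁ + T₂ ≤ t) : V t = 0 := by
  have hone : V T₂ ≤ 1 := by
    by_contra hlt
    push Not at hlt
    have h1 := h.sub_le le_rfl hT₂ (by linarith) fun v hv _ => hW₂ v (by linarith)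
    have h2 := hWT₂ (V 0) (hlt.le.trans (h.antitoneOn (mem_Ici.2 le_rfl) hT₂ hT₂))
    linarith [(hWT₂ (V T₂) hlt.le).2, h2.1]
  refine h.eq_zero_of_le (add_nonneg hT₁ hT₂) ?_ ht
  by_contra hne
  have hpos : 0 < V (T₁ + T₂) := lt_of_le_of_ne (h.nonneg _) (Ne.symm hne)
  have h1 := h.sub_le hT₂ (le_add_of_nonneg_left hT₁) hpos fun v hv _ => hW₁ v (hpos.trans_le hv)
  have hle := h.antitoneOn hT₂ (mem_Ici.2 (add_nonneg hT₁ hT₂)) (le_add_of_nonneg_left hT₁)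
  have h2 := hWT₁ (V T₂) (hpos.trans_le hle) hone
  linarith [(hWT₁ (V (T₁ + T₂)) hpos (hle.trans hone)).1, h2.2]

/-- An antiderivative of `1 / (M v^r)`. -/
theorem hasDerivAt_rpow_div {M r v : ℝ} (hr : r ≠ 1) (hv : 0 < v) :
    HasDerivAt (fun v : ℝ => v ^ (1 - r) / (M * (1 - r))) (v ^ (-r) / M) v := by
  have h1 : 1 - r ≠ 0 := sub_ne_zero.2 hr.symm
  refine ((Real.hasDerivAt_rpow_const (p := 1 - r)
    (Or.inl hv.ne')).div_const (M * (1 - r))).congr_deriv ?_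
  rw [show 1 - r - 1 = -r by ring, mul_comm M, mul_div_mul_left _ _ h1]

/-- An antiderivative of `1 / (M v^r + N v)`. -/
theorem hasDerivAt_log_rpow_div {M N r v : ℝ} (hM : 0 < M) (hN : 0 < N) (hr : r ≠ 1)
    (hv : 0 < v) :
    HasDerivAt (fun v : ℝ => Real.log (1 + N / M * v ^ (1 - r)) / (N * (1 - r)))
      (v ^ (-r) / (M + N * v ^ (1 - r))) v := by
  have h1 : 1 - r ≠ 0 := sub_ne_zero.2 hr.symm
  have hp : 0 < v ^ (1 - r) := Real.rpow_pos_of_pos hv _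
  refine (((((Real.hasDerivAt_rpow_const (p := 1 - r) (Or.inl hv.ne')).const_mul
    (N / M)).const_add 1).log (by positivity)).div_const (N * (1 - r))).congr_deriv ?_
  rw [show 1 - r - 1 = -r by ring]
  field_simp

/-- An antiderivative of `1 / (M v^(1-s) + N v^(1+s))`. -/
theorem hasDerivAt_arctan_rpow {M N s v : ℝ} (hM : 0 < M) (hN : 0 < N) (hs : 0 < s)
    (hv : 0 < v) :
    HasDerivAt (fun v : ℝ => 1 / (s * √(M * N)) * Real.arctan (√(N / M) * v ^ s))
      (v ^ (s - 1) / (M + N * v ^ (2 * s))) v := by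
  refine ((((Real.hasDerivAt_rpow_const (p := s) (Or.inl hv.ne')).const_mul
    √(N / M)).arctan).const_mul (1 / (s * √(M * N)))).congr_deriv ?_
  have hp : 0 < v ^ s := Real.rpow_pos_of_pos hv _
  have e1 : (√(N / M) * v ^ s) ^ 2 = N / M * v ^ (2 * s) := by
    rw [mul_pow, Real.sq_sqrt (by positivity), mul_comm 2 s, Real.rpow_mul hv.le, Real.rpow_two]
  have e2 : √(M * N) = M * √(N / M) := by
    rw [show M * N = M ^ 2 * (N / M) by field_simp, Real.sqrt_mul (by positivity),
      Real.sqrt_sq hM.le]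
  have hq : 0 < √(N / M) := by positivity
  have hp2 : 0 < v ^ (2 * s) := Real.rpow_pos_of_pos hv _
  rw [e1, e2]
  field_simp

variable {M₁ M₂ M₃ r₁ r₂ : ℝ}

/-- Only `M₂ v^r₂` is kept while `V ≥ 1`, and only `M₁ v^r₁` below; each is integrable on its own
range. -/
theorem IsDecaying.eq_zero_of_rpow (hM₁ : 0 < M₁) (hM₂ : 0 < M₂) (hM₃ : 0 ≤ M₃) (hr₁ : r₁ < 1)
    (hr₂ : 1 < r₂) (h : IsDecaying (fun v => M₁ * v ^ r₁ + M₂ * v ^ r₂ + M₃ * v) V) {t : ℝ}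
    (ht : 1 / (M₁ * (1 - r₁)) + 1 / (M₂ * (r₂ - 1)) ≤ t) : V t = 0 := by
  have h1 : 0 < 1 - r₁ := sub_pos.2 hr₁
  have h2 : 0 < r₂ - 1 := sub_pos.2 hr₂
  have hneg : ∀ v : ℝ, v ^ (1 - r₂) / (M₂ * (1 - r₂)) = -(v ^ (1 - r₂) / (M₂ * (r₂ - 1))) := by
    intro v
    rw [← neg_sub r₂ 1, mul_neg, div_neg]
  refine h.eq_zero_of_two_phases (by positivity) (by positivity)
    (fun v hv => ⟨hasDerivAt_rpow_div (M := M₁) hr₁.ne hv, by positivity, ?_⟩)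
    (fun v hv hv1 => ⟨by positivity, ?_⟩)
    (fun v hv => ⟨hasDerivAt_rpow_div (M := M₂) hr₂.ne' hv, by positivity, ?_⟩)
    (fun v hv => ?_) ht
  · have e : v ^ (-r₁) / M₁ * (M₁ * v ^ r₁) = 1 := by
      rw [Real.rpow_neg hv.le]
      field_simp
    rw [← e]
    gcongr
    rw [add_assoc]
    exact le_add_of_nonneg_right (by positivity)
  · gcongr
    exact Real.rpow_le_one hv.le hv1 h1.le
  · have e : v ^ (-r₂) / M₂ * (M₂ * v ^ r₂) = 1 := by
      rw [Real.rpow_neg hv.le]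
      field_simp
    rw [← e]
    gcongr
    rw [add_right_comm]
    exact le_add_of_nonneg_left (by positivity)
  · have hv0 : 0 < v := by linarith
    rw [hneg]
    refine ⟨neg_lt_zero.2 (by positivity), neg_le_neg ?_⟩
    gcongr
    exact Real.rpow_le_one_of_one_le_of_nonpos hv (by linarith)

/-- The same splitting at `1`, with the linear term kept in both phases; this produces the
logarithms. -/
theorem IsDecaying.eq_zero_of_rpow_linear (hM₁ : 0 < M₁) (hM₂ : 0 < M₂) (hM₃ : 0 < M₃)
    (hr₁ : r₁ < 1) (hr₂ : 1 < r₂)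
    (h : IsDecaying (fun v => M₁ * v ^ r₁ + M₂ * v ^ r₂ + M₃ * v) V) {t : ℝ}
    (ht : Real.log (1 + M₃ / M₁) / (M₃ * (1 - r₁)) +
      Real.log (1 + M₃ / M₂) / (M₃ * (r₂ - 1)) ≤ t) : V t = 0 := by
  have h1 : 0 < 1 - r₁ := sub_pos.2 hr₁
  have h2 : 0 < r₂ - 1 := sub_pos.2 hr₂
  have hlog : ∀ x : ℝ, 0 < x → 0 < Real.log (1 + x) := fun x hx => Real.log_pos (by linarith)
  have hlog₁ := hlog (M₃ / M₁) (by positivity)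
  have hlog₂ := hlog (M₃ / M₂) (by positivity)
  have hneg : ∀ x : ℝ, x / (M₃ * (1 - r₂)) = -(x / (M₃ * (r₂ - 1))) := by
    intro v
    rw [← neg_sub r₂ 1, mul_neg, div_neg]
  have key : ∀ M r v : ℝ, 0 < M → 0 < v →
      v ^ (-r) / (M + M₃ * v ^ (1 - r)) * (M * v ^ r + M₃ * v) = 1 := by
    intro M r v hM hv
    have hp : 0 < v ^ r := Real.rpow_pos_of_pos hv _
    rw [Real.rpow_neg hv.le, Real.rpow_sub hv, Real.rpow_one]
    field_simp
  refine h.eq_zero_of_two_phases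
    (W₁' := fun v => v ^ (-r₁) / (M₁ + M₃ * v ^ (1 - r₁)))
    (W₂' := fun v => v ^ (-r₂) / (M₂ + M₃ * v ^ (1 - r₂))) (by positivity) (by positivity)
    (fun v hv => ⟨hasDerivAt_log_rpow_div hM₁ hM₃ hr₁.ne hv, by positivity, ?_⟩)
    (fun v hv hv1 => ⟨?_, ?_⟩)
    (fun v hv => ⟨hasDerivAt_log_rpow_div hM₂ hM₃ hr₂.ne' hv, by positivity, ?_⟩)
    (fun v hv => ?_) ht
  · refine (key M₁ r₁ v hM₁ hv).ge.trans ?_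
    refine mul_le_mul_of_nonneg_left ?_ (by positivity)
    have : 0 ≤ M₂ * v ^ r₂ := by positivity
    linarith
  · have := hlog (M₃ / M₁ * v ^ (1 - r₁)) (by positivity)
    positivity
  · gcongr
    exact mul_le_of_le_one_right (by positivity) (Real.rpow_le_one hv.le hv1 h1.le)
  · refine (key M₂ r₂ v hM₂ hv).ge.trans ?_
    refine mul_le_mul_of_nonneg_left ?_ (by positivity)
    have : 0 ≤ M₁ * v ^ r₁ := by positivity
    linarith
  · have hv0 : 0 < v := by linarith
    have := hlog (M₃ / M₂ * v ^ (1 - r₂)) (by positivity)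
    rw [hneg]
    refine ⟨neg_lt_zero.2 (by positivity), neg_le_neg ?_⟩
    gcongr
    exact mul_le_of_le_one_right (by positivity)
      (Real.rpow_le_one_of_one_le_of_nonpos hv (by linarith))

/-- For exponents `1 ∓ s` both powers integrate together to an arctangent. Its bound `π / 2` covers
all `v > 0` in one phase. -/
theorem IsDecaying.eq_zero_of_rpow_symm {ζ : ℝ} (hM₁ : 0 < M₁) (hM₂ : 0 < M₂) (hM₃ : 0 ≤ M₃)
    (hζ : 0 < ζ) (hr₁ : r₁ = 1 - 1 / (2 * ζ)) (hr₂ : r₂ = 1 + 1 / (2 * ζ))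
    (h : IsDecaying (fun v => M₁ * v ^ r₁ + M₂ * v ^ r₂ + M₃ * v) V) {t : ℝ}
    (ht : Real.pi * ζ / √(M₁ * M₂) ≤ t) : V t = 0 := by
  set s := 1 / (2 * ζ) with hs
  have hs0 : 0 < s := by positivity
  have hζs : ζ = 1 / (2 * s) := by rw [hs]; field_simp
  refine h.eq_zero (W' := fun v => v ^ (s - 1) / (M₁ + M₂ * v ^ (2 * s))) (by positivity)
    (fun v hv => ⟨hasDerivAt_arctan_rpow hM₁ hM₂ hs0 hv, by positivity, ?_⟩)
    (fun v hv => ⟨?_, ?_⟩) ht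
  · have e : v ^ (s - 1) / (M₁ + M₂ * v ^ (2 * s)) * (M₁ * v ^ r₁ + M₂ * v ^ r₂) = 1 := by
      have hp : 0 < v ^ s := Real.rpow_pos_of_pos hv _
      rw [hr₁, hr₂, Real.rpow_sub hv, Real.rpow_sub hv, Real.rpow_add hv, Real.rpow_one, two_mul,
        Real.rpow_add hv]
      field_simp
    refine e.ge.trans ?_
    refine mul_le_mul_of_nonneg_left ?_ (by positivity)
    exact le_add_of_nonneg_right (by positivity)
  · have : 0 < Real.arctan (√(M₂ / M₁) * v ^ s) := Real.arctan_pos.2 (by positivity)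
    positivity
  · calc 1 / (s * √(M₁ * M₂)) * Real.arctan (√(M₂ / M₁) * v ^ s)
        ≤ 1 / (s * √(M₁ * M₂)) * (Real.pi / 2) := by
          gcongr
          exact (Real.arctan_lt_pi_div_two _).le
      _ = Real.pi * ζ / √(M₁ * M₂) := by
          rw [hζs]
          field_simp

end Decay

/-! ### The Lyapunov estimate for the weighted residual field. -/

section Flow

open Set

theorem settlingTime_le {H : Type*} [NormedAddCommGroup H] [NormedSpace ℝ H] {z : ℝ → H} {zs : H}
    {T : ℝ} (hT : 0 ≤ T) (h : ∀ t, T ≤ t → z t = zs) : settlingTime z zs ≤ ENNReal.ofReal T :=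
  iInf₂_le T.toNNReal (by simpa [Real.coe_toNNReal _ hT] using h)

variable {H : Type*} [NormedAddCommGroup H] [InnerProductSpace ℝ H] {c : ℝ} {zs : H}

theorem IsCurveAwayFrom.isDecaying {f : H → H} {z : ℝ → H} {D : ℝ → ℝ}
    (hz : IsCurveAwayFrom zs f z) (hf : IsDissipativeField zs f)
    (hD : ∀ x, x ≠ zs → D (‖x - zs‖ ^ 2 / 2) ≤ -inner ℝ (x - zs) (f x)) :
    IsDecaying D (fun t => ‖z t - zs‖ ^ 2 / 2) := by
  refine ⟨(hz.continuousOn_norm.pow 2).div_const 2, fun a ha b _ hab => ?_, fun t => by positivity,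
    fun t ht hVt => ?_⟩
  · have := hz.norm_le hf ha hab
    gcongr
  · have hne : z t ≠ zs := by
      intro h'
      simp [h'] at hVt
    refine ⟨_, (hz.hasDerivAt_norm_sq ht hne).div_const 2, ?_⟩
    have := hD (z t) hne
    linarith

variable {Φ : H → H} {k b₁ b₂ b₃ p₁ p₂ p₃ : ℝ}

/-- The positive weight `k ω`, as a function of `‖Φ‖`. -/
noncomputable def gain (k b₁ b₂ b₃ p₁ p₂ p₃ ρ : ℝ) : ℝ :=
  k * (b₁ * (1 / ρ ^ (1 - p₁)) + b₂ * (1 / ρ ^ (1 - p₂)) + b₃ * (1 / ρ ^ p₃))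

theorem gain_pos (hk : 0 < k) (hb₁ : 0 < b₁) (hb₂ : 0 < b₂) (hb₃ : 0 < b₃) {ρ : ℝ} (hρ : 0 < ρ) :
    0 < gain k b₁ b₂ b₃ p₁ p₂ p₃ ρ := by
  unfold gain
  positivity

theorem exists_lipschitzOnWith_gain (a b : ℝ) (ha : 0 < a) :
    ∃ K : ℝ≥0, LipschitzOnWith K (gain k b₁ b₂ b₃ p₁ p₂ p₃) (Icc a b) := by
  have hne : ∀ ρ ∈ Icc a b, ρ ≠ 0 := fun ρ hρ => (ha.trans_le hρ.1).ne'
  have hr : ∀ p : ℝ, ContDiffOn ℝ 1 (fun ρ : ℝ => 1 / ρ ^ p) (Icc a b) := fun p =>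
    contDiffOn_const.div (contDiffOn_id.rpow_const_of_ne hne) fun ρ hρ =>
      (Real.rpow_pos_of_pos (ha.trans_le hρ.1) _).ne'
  have h : ContDiffOn ℝ 1 (gain k b₁ b₂ b₃ p₁ p₂ p₃) (Icc a b) :=
    contDiffOn_const.mul (((contDiffOn_const.mul (hr _)).add (contDiffOn_const.mul (hr _))).add
      (contDiffOn_const.mul (hr _)))
  exact h.exists_lipschitzOnWith one_ne_zero (convex_Icc a b) isCompact_Icc

theorem two_rpow_mul_sq_div_two_rpow {v : ℝ} (hv : 0 ≤ v) (p : ℝ) :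
    (2 : ℝ) ^ ((1 + p) / 2) * (v ^ 2 / 2) ^ ((1 + p) / 2) = v ^ (1 + p) := by
  rw [← Real.mul_rpow (by norm_num) (by positivity), mul_div_cancel₀ _ two_ne_zero,
    ← Real.rpow_natCast, ← Real.rpow_mul hv]
  congr 1
  push_cast
  ring

/-- The Lyapunov estimate for `‖x - zs‖² / 2` along the flow. -/
theorem IsResidualLike.decay_le (h : IsResidualLike c zs Φ) (hk : 0 < k) (hb₁ : 0 < b₁)
    (hb₂ : 0 < b₂) (hp₁ : p₁ < 1) (hp₂ : 1 < p₂) {M₃ : ℝ} {x : H} (hx : x ≠ zs)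
    (hM₃ : M₃ ≤ 2 * (k * (b₃ * (1 / ‖Φ x‖ ^ p₃)) * (1 - c))) (hb₃ : 0 < b₃) :
    (2 : ℝ) ^ ((1 + p₁) / 2) * k * (b₁ * (1 - c) / (1 + c) ^ (1 - p₁)) *
        (‖x - zs‖ ^ 2 / 2) ^ ((1 + p₁) / 2) +
      (2 : ℝ) ^ ((1 + p₂) / 2) * k * ((1 - c) ^ p₂ * b₂) * (‖x - zs‖ ^ 2 / 2) ^ ((1 + p₂) / 2) +
      M₃ * (‖x - zs‖ ^ 2 / 2) ≤
    -inner ℝ (x - zs) (-(gain k b₁ b₂ b₃ p₁ p₂ p₃ ‖Φ x‖) • Φ x) := by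
  have hc1 : 0 < 1 - c := sub_pos.2 h.lt_one
  have hc2 : 0 < 1 + c := by linarith [h.pos]
  set v := ‖x - zs‖ with hv
  set ρ := ‖Φ x‖ with hρ
  have hv0 : 0 < v := norm_pos_iff.2 (sub_ne_zero.2 hx)
  have hge : (1 - c) * v ≤ ρ := h.norm_ge x
  have hle : ρ ≤ (1 + c) * v := h.norm_le x
  have hρ0 : 0 < ρ := lt_of_lt_of_le (by positivity) hge
  -- Since `1 - p₁ > 0`, the worst case is the largest residual, `ρ = (1 + c) v`.
  have t1 : (2 : ℝ) ^ ((1 + p₁) / 2) * k * (b₁ * (1 - c) / (1 + c) ^ (1 - p₁)) *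
      (v ^ 2 / 2) ^ ((1 + p₁) / 2) ≤ k * (b₁ * (1 / ρ ^ (1 - p₁))) * ((1 - c) * v ^ 2) := by
    have e : (2 : ℝ) ^ ((1 + p₁) / 2) * k * (b₁ * (1 - c) / (1 + c) ^ (1 - p₁)) *
        (v ^ 2 / 2) ^ ((1 + p₁) / 2) =
        k * (b₁ * (1 / ((1 + c) * v) ^ (1 - p₁))) * ((1 - c) * v ^ 2) := by
      have e1 := two_rpow_mul_sq_div_two_rpow hv0.le p₁
      have e2 : v ^ 2 = v ^ (1 + p₁) * v ^ (1 - p₁) := by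
        rw [← Real.rpow_add hv0, ← Real.rpow_natCast]
        congr 1
        push_cast
        ring
      have hq : 0 < v ^ (1 - p₁) := by positivity
      have hq' : 0 < (1 + c) ^ (1 - p₁) := by positivity
      calc _ = k * (b₁ * (1 - c) / (1 + c) ^ (1 - p₁)) *
            ((2 : ℝ) ^ ((1 + p₁) / 2) * (v ^ 2 / 2) ^ ((1 + p₁) / 2)) := by ring
        _ = _ := by
          rw [e1, e2, Real.mul_rpow hc2.le hv0.le]
          field_simp
    rw [e]
    gcongr
  -- Since `p₂ - 1 > 0`, the worst case is now the smallest residual, `ρ = (1 - c) v`.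
  have t2 : (2 : ℝ) ^ ((1 + p₂) / 2) * k * ((1 - c) ^ p₂ * b₂) * (v ^ 2 / 2) ^ ((1 + p₂) / 2) ≤
      k * (b₂ * (1 / ρ ^ (1 - p₂))) * ((1 - c) * v ^ 2) := by
    have e : (2 : ℝ) ^ ((1 + p₂) / 2) * k * ((1 - c) ^ p₂ * b₂) * (v ^ 2 / 2) ^ ((1 + p₂) / 2) =
        k * (b₂ * ((1 - c) * v) ^ (p₂ - 1)) * ((1 - c) * v ^ 2) := by
      have e1 := two_rpow_mul_sq_div_two_rpow hv0.le p₂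
      have e2 : v ^ (1 + p₂) = v ^ (p₂ - 1) * v ^ 2 := by
        rw [← Real.rpow_natCast, ← Real.rpow_add hv0]
        congr 1
        push_cast
        ring
      have e3 : (1 - c) ^ p₂ = (1 - c) ^ (p₂ - 1) * (1 - c) := by
        rw [← Real.rpow_add_one hc1.ne']
        congr 1
        ring
      calc _ = k * ((1 - c) ^ p₂ * b₂) *
            ((2 : ℝ) ^ ((1 + p₂) / 2) * (v ^ 2 / 2) ^ ((1 + p₂) / 2)) := by ring
        _ = _ := by
          rw [e1, e2, e3, Real.mul_rpow hc1.le hv0.le]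
          ring
    have e' : 1 / ρ ^ (1 - p₂) = ρ ^ (p₂ - 1) := by
      rw [one_div, ← Real.rpow_neg hρ0.le, neg_sub]
    rw [e, e']
    gcongr
  have t3 : M₃ * (v ^ 2 / 2) ≤ k * (b₃ * (1 / ρ ^ p₃)) * ((1 - c) * v ^ 2) := by
    calc _ ≤ 2 * (k * (b₃ * (1 / ρ ^ p₃)) * (1 - c)) * (v ^ 2 / 2) := by gcongr
      _ = _ := by ring
  have hg : 0 < gain k b₁ b₂ b₃ p₁ p₂ p₃ ρ := gain_pos hk hb₁ hb₂ hb₃ hρ0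
  have hfin := mul_le_mul_of_nonneg_left (h.inner_ge x) hg.le
  rw [real_inner_smul_right, neg_mul, neg_neg]
  refine le_trans ?_ hfin
  unfold gain
  linarith

/-- The convention for the weight on the zero set of `Φ` is immaterial, because the factor `Φ`
vanishes there. -/
theorem flowField_eq {F : H → Set H} {G : H → H} {γ Kp Tp : ℝ} :
    flowField F G γ b₁ b₂ b₃ p₁ p₂ p₃ Kp Tp = fun x =>
      -(gain (Kp / Tp) b₁ b₂ b₃ p₁ p₂ p₃ ‖residual F G γ x‖) • residual F G γ x := by
  funext x
  by_cases hx : residual F G γ x = 0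
  · simp [flowField, hx]
  · simp [flowField, weight, hx, gain]

end Flow

/-! ### Settling times and assembly of the theorem. -/

section Main

open Set

theorem predefinedGain_pos {c b₁ b₂ b₃ p₁ p₂ : ℝ} (hc : 0 < c) (hc1 : c < 1) (hb₁ : 0 < b₁)
    (hb₂ : 0 < b₂) (hb₃ : 0 < b₃) (hp₁ : p₁ < 1) (hp₂ : 1 < p₂) :
    0 < predefinedGain c b₁ b₂ b₃ p₁ p₂ := by
  have h1 : 0 < 1 - c := sub_pos.2 hc1
  have h2 : 0 < 1 - p₁ := sub_pos.2 hp₁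
  have h3 : 0 < p₂ - 1 := sub_pos.2 hp₂
  have hlog : ∀ x : ℝ, 0 < x → 0 < Real.log (1 + x) := fun x hx => Real.log_pos (by linarith)
  have h4 := hlog (b₃ * (2 : ℝ) ^ ((1 - p₁) / 2) * (1 + c) ^ (1 - p₁) / b₁) (by positivity)
  have h5 := hlog (b₃ * (2 : ℝ) ^ ((1 - p₂) / 2) * (1 - c) ^ (1 - p₂) / b₂) (by positivity)
  unfold predefinedGain
  positivity

theorem two_eq_rpow_mul_rpow (p : ℝ) :
    (2 : ℝ) = (2 : ℝ) ^ ((1 + p) / 2) * (2 : ℝ) ^ ((1 - p) / 2) := by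
  rw [← Real.rpow_add two_pos, show (1 + p) / 2 + (1 - p) / 2 = 1 by ring, Real.rpow_one]

/-- With the predefined gain, the two phases of the decay last `Tp` together. -/
theorem phases_eq_of_predefinedGain {c b₁ b₂ b₃ p₁ p₂ Tp : ℝ} (hc : 0 < c) (hc1 : c < 1)
    (hb₁ : 0 < b₁) (hb₂ : 0 < b₂) (hb₃ : 0 < b₃) (hp₁ : p₁ < 1) (hp₂ : 1 < p₂) (hTp : 0 < Tp)
    {k : ℝ} (hk : k = predefinedGain c b₁ b₂ b₃ p₁ p₂ / Tp) :
    Real.log (1 + 2 * (k * b₃ * (1 - c)) /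
        ((2 : ℝ) ^ ((1 + p₁) / 2) * k * (b₁ * (1 - c) / (1 + c) ^ (1 - p₁)))) /
          (2 * (k * b₃ * (1 - c)) * (1 - (1 + p₁) / 2)) +
      Real.log (1 + 2 * (k * b₃ * (1 - c)) /
        ((2 : ℝ) ^ ((1 + p₂) / 2) * k * ((1 - c) ^ p₂ * b₂))) /
          (2 * (k * b₃ * (1 - c)) * ((1 + p₂) / 2 - 1)) = Tp := by
  have hg := predefinedGain_pos hc hc1 hb₁ hb₂ hb₃ hp₁ hp₂
  have hk0 : 0 < k := hk ▸ div_pos hg hTp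
  have h1 : 0 < 1 - c := sub_pos.2 hc1
  have h2 : 0 < 1 - p₁ := sub_pos.2 hp₁
  have h3 : 0 < p₂ - 1 := sub_pos.2 hp₂
  -- `k` cancels from the ratios inside the logarithms, so it survives only in the outer
  -- denominators and the sum is the predefined gain divided by `k`.
  have e1 : 2 * (k * b₃ * (1 - c)) /
      ((2 : ℝ) ^ ((1 + p₁) / 2) * k * (b₁ * (1 - c) / (1 + c) ^ (1 - p₁))) =
      b₃ * (2 : ℝ) ^ ((1 - p₁) / 2) * (1 + c) ^ (1 - p₁) / b₁ := by
    nth_rewrite 1 [two_eq_rpow_mul_rpow p₁]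
    have : 0 < (1 + c) ^ (1 - p₁) := by positivity
    field_simp
  have e2 : 2 * (k * b₃ * (1 - c)) / ((2 : ℝ) ^ ((1 + p₂) / 2) * k * ((1 - c) ^ p₂ * b₂)) =
      b₃ * (2 : ℝ) ^ ((1 - p₂) / 2) * (1 - c) ^ (1 - p₂) / b₂ := by
    nth_rewrite 1 [two_eq_rpow_mul_rpow p₂]
    rw [Real.rpow_sub h1, Real.rpow_one]
    have : 0 < (1 - c) ^ p₂ := by positivity
    field_simp
  rw [e1, e2, show 1 - (1 + p₁) / 2 = (1 - p₁) / 2 by ring,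
    show (1 + p₂) / 2 - 1 = (p₂ - 1) / 2 by ring]
  have hkT : k * Tp = predefinedGain c b₁ b₂ b₃ p₁ p₂ := by
    rw [hk]
    field_simp
  refine mul_left_cancel₀ hk0.ne' ?_
  rw [hkT]
  unfold predefinedGain
  field_simp

variable {H : Type*} [NormedAddCommGroup H] [InnerProductSpace ℝ H]
  {F : H → Set H} {G : H → H} {γ c : ℝ} {zs : H} {b₁ b₂ b₃ p₁ p₂ p₃ Kp Tp : ℝ}

theorem isDissipativeField_flowField (hc : IsContractionConstant F G γ c)
    (hzs : residual F G γ zs = 0) (hb₁ : 0 < b₁) (hb₂ : 0 < b₂) (hb₃ : 0 < b₃) (hKp : 0 < Kp)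
    (hTp : 0 < Tp) : IsDissipativeField zs (flowField F G γ b₁ b₂ b₃ p₁ p₂ p₃ Kp Tp) := by
  rw [flowField_eq]
  exact (hc.isResidualLike hzs).isDissipativeField
    (fun _ hρ => gain_pos (div_pos hKp hTp) hb₁ hb₂ hb₃ hρ) exists_lipschitzOnWith_gain

theorem isWellPosed_flowField [FiniteDimensional ℝ H]
    (hc : IsContractionConstant F G γ c)
    (hzs : residual F G γ zs = 0) (hb₁ : 0 < b₁) (hb₂ : 0 < b₂) (hb₃ : 0 < b₃) (hKp : 0 < Kp)
    (hTp : 0 < Tp) : IsWellPosed (flowField F G γ b₁ b₂ b₃ p₁ p₂ p₃ Kp Tp) := by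
  have := FiniteDimensional.complete ℝ H
  rw [flowField_eq]
  exact (hc.isResidualLike hzs).isWellPosed
    (fun _ hρ => gain_pos (div_pos hKp hTp) hb₁ hb₂ hb₃ hρ) exists_lipschitzOnWith_gain

theorem flowField_eq_zero_iff (hc : IsContractionConstant F G γ c)
    (hzs : residual F G γ zs = 0) (hb₁ : 0 < b₁) (hb₂ : 0 < b₂) (hb₃ : 0 < b₃) (hKp : 0 < Kp)
    (hTp : 0 < Tp) (z : H) : flowField F G γ b₁ b₂ b₃ p₁ p₂ p₃ Kp Tp z = 0 ↔ z = zs := by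
  have hR := hc.isResidualLike hzs
  rw [flowField_eq, ← hR.eq_zero_iff]
  refine ⟨fun h => ?_, fun h => by simp [h]⟩
  by_contra hne
  have hg := gain_pos (p₁ := p₁) (p₂ := p₂) (p₃ := p₃) (div_pos hKp hTp) hb₁ hb₂ hb₃
    (norm_pos_iff.2 hne)
  exact (smul_ne_zero (neg_ne_zero.2 hg.ne') hne) h

/-- The Lyapunov function `‖z - zs‖² / 2` decays along every solution. -/
theorem isDecaying_of_isSolution [FiniteDimensional ℝ H]
    (hc : IsContractionConstant F G γ c)
    (hzs : residual F G γ zs = 0) (hb₁ : 0 < b₁) (hb₂ : 0 < b₂) (hb₃ : 0 < b₃) (hp₁ : p₁ < 1)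
    (hp₂ : 1 < p₂) (hKp : 0 < Kp) (hTp : 0 < Tp) {M₃ : ℝ}
    (hM₃ : ∀ x, x ≠ zs → M₃ ≤ 2 * (Kp / Tp * (b₃ * (1 / ‖residual F G γ x‖ ^ p₃)) * (1 - c)))
    {z : ℝ → H} (hz : IsSolution (flowField F G γ b₁ b₂ b₃ p₁ p₂ p₃ Kp Tp) z) :
    IsDecaying (fun v =>
      (2 : ℝ) ^ ((1 + p₁) / 2) * (Kp / Tp) * (b₁ * (1 - c) / (1 + c) ^ (1 - p₁)) *
          v ^ ((1 + p₁) / 2) +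
        (2 : ℝ) ^ ((1 + p₂) / 2) * (Kp / Tp) * ((1 - c) ^ p₂ * b₂) * v ^ ((1 + p₂) / 2) +
        M₃ * v) (fun t => ‖z t - zs‖ ^ 2 / 2) := by
  have := FiniteDimensional.complete ℝ H
  have hf := isDissipativeField_flowField (p₁ := p₁) (p₂ := p₂) (p₃ := p₃)
    hc hzs hb₁ hb₂ hb₃ hKp hTp
  refine (hf.isCurveAwayFrom hz).isDecaying hf fun x hx => ?_
  rw [flowField_eq]
  exact (hc.isResidualLike hzs).decay_le (div_pos hKp hTp) hb₁ hb₂ hp₁ hp₂ hx (hM₃ x hx) hb₃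

theorem eq_of_norm_sub_sq_div_two_eq_zero {E : Type*} [NormedAddCommGroup E] {x y : E}
    (h : ‖x - y‖ ^ 2 / 2 = 0) : x = y := by
  simpa [sub_eq_zero] using h

theorem settlingTime_le_of_isSolution [FiniteDimensional ℝ H]
    (hc : IsContractionConstant F G γ c)
    (hzs : residual F G γ zs = 0) (hb₁ : 0 < b₁) (hb₂ : 0 < b₂) (hb₃ : 0 < b₃) (hp₁ : p₁ < 1)
    (hp₂ : 1 < p₂) (hKp : 0 < Kp) (hTp : 0 < Tp) {M₁ M₂ r₁ r₂ : ℝ} (hr₁ : r₁ = (1 + p₁) / 2)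
    (hr₂ : r₂ = (1 + p₂) / 2)
    (hM₁ : M₁ = (2 : ℝ) ^ ((1 + p₁) / 2) * (Kp / Tp) * (b₁ * (1 - c) / (1 + c) ^ (1 - p₁)))
    (hM₂ : M₂ = (2 : ℝ) ^ ((1 + p₂) / 2) * (Kp / Tp) * ((1 - c) ^ p₂ * b₂))
    (hM₁0 : 0 < M₁) (hM₂0 : 0 < M₂)
    {z : ℝ → H} (hz : IsSolution (flowField F G γ b₁ b₂ b₃ p₁ p₂ p₃ Kp Tp) z) :
    settlingTime z zs ≤ ENNReal.ofReal (1 / (M₁ * (1 - r₁)) + 1 / (M₂ * (r₂ - 1))) ∧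
      ∀ ζ : ℝ, 1 < ζ → r₁ = 1 - 1 / (2 * ζ) → r₂ = 1 + 1 / (2 * ζ) →
        settlingTime z zs ≤ ENNReal.ofReal (Real.pi * ζ / Real.sqrt (M₁ * M₂)) := by
  have hc1 : 0 < 1 - c := sub_pos.2 hc.2.1
  -- `M₃ = 0`: for `p₃ > 0` the `b₃` term has no uniform linear lower bound, because `1 / ‖Φ‖ ^ p₃`
  -- gets small for large residuals.
  have hd := isDecaying_of_isSolution hc hzs hb₁ hb₂ hb₃ hp₁ hp₂ hKp hTp (M₃ := 0)
    (fun x _ => by positivity) hz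
  rw [← hM₁, ← hM₂, ← hr₁, ← hr₂] at hd
  have h1 : r₁ < 1 := by linarith
  have h2 : 1 < r₂ := by linarith
  have h1' : 0 < 1 - r₁ := sub_pos.2 h1
  have h2' : 0 < r₂ - 1 := sub_pos.2 h2
  refine ⟨settlingTime_le (by positivity) fun t ht => eq_of_norm_sub_sq_div_two_eq_zero ?_,
    fun ζ hζ e1 e2 => settlingTime_le (by positivity) fun t ht =>
      eq_of_norm_sub_sq_div_two_eq_zero ?_⟩
  · exact hd.eq_zero_of_rpow hM₁0 hM₂0 le_rfl h1 h2 ht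
  · exact hd.eq_zero_of_rpow_symm hM₁0 hM₂0 le_rfl (by linarith) e1 e2 ht

theorem eq_of_predefinedGain [FiniteDimensional ℝ H]
    (hc : IsContractionConstant F G γ c)
    (hzs : residual F G γ zs = 0) (hb₁ : 0 < b₁) (hb₂ : 0 < b₂) (hb₃ : 0 < b₃) (hp₁ : p₁ < 1)
    (hp₂ : 1 < p₂) (hTp : 0 < Tp) {z : ℝ → H}
    (hz : IsSolution
      (flowField F G γ b₁ b₂ b₃ p₁ p₂ 0 (predefinedGain c b₁ b₂ b₃ p₁ p₂) Tp) z)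
    {t : ℝ} (ht : Tp ≤ t) : z t = zs := by
  have hc0 := hc.1
  have hc1 : 0 < 1 - c := sub_pos.2 hc.2.1
  have hKp := predefinedGain_pos hc.1 hc.2.1 hb₁ hb₂ hb₃ hp₁ hp₂
  set k := predefinedGain c b₁ b₂ b₃ p₁ p₂ / Tp with hk
  have hk0 : 0 < k := div_pos hKp hTp
  -- For `p₃ = 0` the `b₃` part of the weight is constant and supplies a genuine linear term.
  have hd := isDecaying_of_isSolution hc hzs hb₁ hb₂ hb₃ hp₁ hp₂ hKp hTp
    (M₃ := 2 * (k * b₃ * (1 - c))) (fun x _ => by rw [Real.rpow_zero, div_one, mul_one])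
    hz
  refine eq_of_norm_sub_sq_div_two_eq_zero (hd.eq_zero_of_rpow_linear (by positivity)
    (by positivity) (by positivity) (by linarith) (by linarith) ?_)
  rw [← hk]
  exact (phases_eq_of_predefinedGain hc.1 hc.2.1 hb₁ hb₂ hb₃ hp₁ hp₂ hTp hk).trans_le ht

theorem isLyapunovStable_flowField [FiniteDimensional ℝ H]
    (hc : IsContractionConstant F G γ c)
    (hzs : residual F G γ zs = 0) (hb₁ : 0 < b₁) (hb₂ : 0 < b₂) (hb₃ : 0 < b₃) (hKp : 0 < Kp)
    (hTp : 0 < Tp) : IsLyapunovStable (flowField F G γ b₁ b₂ b₃ p₁ p₂ p₃ Kp Tp) zs := by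
  have := FiniteDimensional.complete ℝ H
  have hf := isDissipativeField_flowField (p₁ := p₁) (p₂ := p₂) (p₃ := p₃)
    hc hzs hb₁ hb₂ hb₃ hKp hTp
  -- The radius `ε` itself works, as distances to `zs` never increase.
  refine fun ε hε => ⟨ε, hε, fun z hz h0 t ht => ?_⟩
  rw [mem_ball_iff_norm] at h0 ⊢
  exact ((hf.isCurveAwayFrom hz).norm_le hf le_rfl ht).trans_lt h0

end Main

end InclusionFlow

theorem mainTheorem1 {H : Type*} [NormedAddCommGroup H] [InnerProductSpace ℝ H]
    [FiniteDimensional ℝ H] (F : H → Set H) (G : H → H) (ηF ηG γ : ℝ) (L : ℝ≥0)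
    (hF : IsMaximalMonotoneWith ηF F)
    (hG : IsMonotoneWith ηG (fun z => {G z}))
    (hGL : LipschitzWith L G)
    (hγ : 0 < γ)
    (hγF : 0 < 1 + γ * ηF)
    (hA : 0 < 2 * (ηF + ηG) + γ * ηF ^ 2 - γ * (L : ℝ) ^ 2) :
    -- the resolvent is everywhere defined and single-valued
    (∀ x : H, ∃! y : H, y ∈ resolventVal F γ x) ∧
    -- the forward-backward operator has a Lipschitz constant in (0,1)
    (∃ c : ℝ, IsContractionConstant F G γ c) ∧
    ∃ zs : H, (∀ z : H, SolvesInclusion F G z ↔ z = zs) ∧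
      ∀ b₁ b₂ b₃ p₁ p₂ : ℝ, 0 < b₁ → 0 < b₂ → 0 < b₃ → 0 < p₁ → p₁ < 1 → 1 < p₂ →
        -- fixed-time stability and settling-time estimates
        (∀ p₃ Kp Tp : ℝ, 0 ≤ p₃ → 0 < Kp → 0 < Tp →
          (∀ z : H, flowField F G γ b₁ b₂ b₃ p₁ p₂ p₃ Kp Tp z = 0 ↔ z = zs) ∧
          IsWellPosed (flowField F G γ b₁ b₂ b₃ p₁ p₂ p₃ Kp Tp) ∧
          IsGloballyFixedTimeStable (flowField F G γ b₁ b₂ b₃ p₁ p₂ p₃ Kp Tp) zs ∧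
          ∀ c : ℝ, IsContractionConstant F G γ c →
            ∃ M₁ M₂ r₁ r₂ : ℝ, 0 < M₁ ∧ 0 < M₂ ∧ 1 / 2 < r₁ ∧ r₁ < 1 ∧ 1 < r₂ ∧
              r₁ = (1 + p₁) / 2 ∧ r₂ = (1 + p₂) / 2 ∧
              M₁ = (2 : ℝ) ^ ((1 + p₁) / 2) * (Kp / Tp) *
                (b₁ * (1 - c) / (1 + c) ^ (1 - p₁)) ∧
              M₂ = (2 : ℝ) ^ ((1 + p₂) / 2) * (Kp / Tp) * ((1 - c) ^ p₂ * b₂) ∧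
              ∀ z : ℝ → H, IsSolution (flowField F G γ b₁ b₂ b₃ p₁ p₂ p₃ Kp Tp) z →
                settlingTime z zs ≤
                  ENNReal.ofReal (1 / (M₁ * (1 - r₁)) + 1 / (M₂ * (r₂ - 1))) ∧
                ∀ ζ : ℝ, 1 < ζ → r₁ = 1 - 1 / (2 * ζ) → r₂ = 1 + 1 / (2 * ζ) →
                  settlingTime z zs ≤ ENNReal.ofReal (Real.pi * ζ / Real.sqrt (M₁ * M₂))) ∧
        -- predefined-time convergence when `p₃ = 0`
        (∀ c : ℝ, IsContractionConstant F G γ c →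
          0 < predefinedGain c b₁ b₂ b₃ p₁ p₂ ∧
          ∀ Tp : ℝ, 0 < Tp → ∀ z : ℝ → H,
            IsSolution
              (flowField F G γ b₁ b₂ b₃ p₁ p₂ 0 (predefinedGain c b₁ b₂ b₃ p₁ p₂) Tp) z →
            settlingTime z zs ≤ ENNReal.ofReal Tp ∧ ∀ t : ℝ, Tp ≤ t → z t = zs) := by
  have := FiniteDimensional.complete ℝ H
  obtain ⟨c₀, hc₀⟩ := exists_isContractionConstant hF hG hGL hγ hγF hA
  obtain ⟨zs, hzs⟩ := hc₀.exists_residual_eq_zero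
  refine ⟨existsUnique_mem_resolventVal hF hγ hγF, ⟨c₀, hc₀⟩, zs, fun z => ?_, ?_⟩
  · rw [solvesInclusion_iff_residual_eq_zero hF hγ hγF, (hc₀.isResidualLike hzs).eq_zero_iff]
  intro b₁ b₂ b₃ p₁ p₂ hb₁ hb₂ hb₃ hp₁0 hp₁ hp₂
  refine ⟨fun p₃ Kp Tp _ hKp hTp => ?_, fun c hc =>
    ⟨predefinedGain_pos hc.1 hc.2.1 hb₁ hb₂ hb₃ hp₁ hp₂, fun Tp hTp z hz => ?_⟩⟩
  · have hset : ∀ c : ℝ, IsContractionConstant F G γ c →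
        ∃ M₁ M₂ r₁ r₂ : ℝ, 0 < M₁ ∧ 0 < M₂ ∧ 1 / 2 < r₁ ∧ r₁ < 1 ∧ 1 < r₂ ∧
          r₁ = (1 + p₁) / 2 ∧ r₂ = (1 + p₂) / 2 ∧
          M₁ = (2 : ℝ) ^ ((1 + p₁) / 2) * (Kp / Tp) *
            (b₁ * (1 - c) / (1 + c) ^ (1 - p₁)) ∧
          M₂ = (2 : ℝ) ^ ((1 + p₂) / 2) * (Kp / Tp) * ((1 - c) ^ p₂ * b₂) ∧
          ∀ z : ℝ → H, IsSolution (flowField F G γ b₁ b₂ b₃ p₁ p₂ p₃ Kp Tp) z →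
            settlingTime z zs ≤
              ENNReal.ofReal (1 / (M₁ * (1 - r₁)) + 1 / (M₂ * (r₂ - 1))) ∧
            ∀ ζ : ℝ, 1 < ζ → r₁ = 1 - 1 / (2 * ζ) → r₂ = 1 + 1 / (2 * ζ) →
              settlingTime z zs ≤ ENNReal.ofReal (Real.pi * ζ / Real.sqrt (M₁ * M₂)) := by
      intro c hc
      have h1 : 0 < 1 - c := sub_pos.2 hc.2.1
      have h2 : 0 < 1 + c := by linarith [hc.1]
      exact ⟨_, _, _, _, by positivity, by positivity, by linarith, by linarith, by linarith,
        rfl, rfl, rfl, rfl, fun z hz => settlingTime_le_of_isSolution hc hzs hb₁ hb₂ hb₃ hp₁ hp₂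
          hKp hTp rfl rfl rfl rfl (by positivity) (by positivity) hz⟩
    -- Any one contraction constant gives the uniform bound; `zs` does not depend on it.
    obtain ⟨M₁, M₂, r₁, r₂, -, -, -, -, -, -, -, -, -, hbound⟩ := hset c₀ hc₀
    exact ⟨flowField_eq_zero_iff hc₀ hzs hb₁ hb₂ hb₃ hKp hTp,
      isWellPosed_flowField hc₀ hzs hb₁ hb₂ hb₃ hKp hTp,
      ⟨⟨(flowField_eq_zero_iff hc₀ hzs hb₁ hb₂ hb₃ hKp hTp zs).2 rfl,
        isLyapunovStable_flowField hc₀ hzs hb₁ hb₂ hb₃ hKp hTp,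
        fun z hz => (hbound z hz).1.trans_lt ENNReal.ofReal_lt_top⟩,
        _, fun z hz => (hbound z hz).1⟩,
      hset⟩
  · have h : ∀ t, Tp ≤ t → z t = zs := fun t ht =>
      eq_of_predefinedGain hc hzs hb₁ hb₂ hb₃ hp₁ hp₂ hTp hz ht
    exact ⟨settlingTime_le hTp.le h, h⟩
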